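/- **Setting.** $\mathbb{D}$ is the open unit disc, $D(0,r)$ the open disc of radius $r$ about $0$, $\mathcal{O}(X,Y)$ the set of holomorphic maps from $X$ to $Y$, $[\,\cdot\,]$ the greatest-integer function, and $$\mathcal{M}_{\mathbb{D}}(z,w)=\left|\frac{z-w}{1-\overline{w}z}\right|\qquad(z,w\in\mathbb{D}).$$ Let $\Omega\subseteq\mathbb{C}$ be a domain, let $C_\Omega(p,q)=\sup\{\mathcal{M}_{\mathbb{D}}(f(p),f(q)) : f\in\mathcal{O}(\Omega,\mathbb{D})\}$ be its Carathéodory pseudo-distance, and assume that $\Omega$ is Carathéodory hyperbolic, i.e. that $C_\Omega$ is a distance. For distinct $p,q\in\Omega$ let $G_\Omega(p,q;\cdot)\in\mathcal{O}(\Omega,\mathbb{D})$ be the unique extremal solution, that is, the unique $g\in\mathcal{O}(\Omega,\mathbb{D})$ with $g(p)=0$ and $g(q)=C_\Omega(p,q)$. Let $n\ge 2$ and $S_n(\Omega)=\{A\in M_n(\mathbb{C}):\sigma(A)\subset\Omega\}$, where $\sigma(A)$ is the set of eigenvalues of $A$. For $f$ holomorphic on $\Omega$ and $A\in S_n(\Omega)$,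 $f(A)$ is defined by the holomorphic functional calculus. **Data.** Let $\zeta_1,\zeta_2,\zeta_3\in\mathbb{D}$ be distinct and let $W_1,W_2,W_3\in S_n(\Omega)$. Let $m(j,\lambda)$ be the multiplicity of $\lambda$ as a zero of the minimal polynomial of $W_j$, and let $\psi_k(\zeta)=(\zeta-\zeta_k)/(1-\overline{\zeta_k}\zeta)$. For $k\in\{1,2,3\}$ and $z\in\Omega\setminus\sigma(W_k)$ put $$B_{k,z}=\prod_{\lambda\in\sigma(W_k)}G_\Omega(\lambda,z;\cdot)^{m(k,\lambda)}\in\mathcal{O}(\Omega,\mathbb{D}).$$ For $j\ne k$ and $\nu\in\sigma(B_{k,z}(W_j))$ put $$q_z(\nu,j,k)=\max\left\{\left[\frac{m(j,\lambda)-1}{\mathrm{ord}_\lambda B_{k,z}'+1}\right]+1 : \lambda\in\sigma(W_j),\ B_{k,z}(\lambda)=\nu\right\},$$ where $\mathrm{ord}_\lambda g$ is the order of vanishing of $g$ at $\lambda$ ($0$ if $g(\lambda)\neq0$). Let $G(k)$ and $L(k)$ be the maximum and the minimum of $\{1,2,3\}\setminus\{k\}$. **Theorem.** Suppose there is a holomorphic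 map $F:\mathbb{D}\to S_n(\Omega)$ with $F(\zeta_j)=W_j$ for $j=1,2,3$. Then for every $k\in\{1,2,3\}$ and every $z\in\Omega\setminus\sigma(W_k)$, writing $G=G(k)$ and $L=L(k)$: * either $\sigma(B_{k,z}(W_{G}))\subset D(0,|\psi_k(\zeta_{G})|)$, $\sigma(B_{k,z}(W_{L}))\subset D(0,|\psi_k(\zeta_{L})|)$, and $$\max\left\{\max_{\mu\in\sigma(B_{k,z}(W_{L}))}\ \prod_{\nu\in\sigma(B_{k,z}(W_{G}))}\mathcal{M}_{\mathbb{D}}\!\left(\frac{\mu}{\psi_k(\zeta_{L})},\frac{\nu}{\psi_k(\zeta_{G})}\right)^{q_z(\nu,G,k)},\ \max_{\mu\in\sigma(B_{k,z}(W_{G}))}\ \prod_{\nu\in\sigma(B_{k,z}(W_{L}))}\mathcal{M}_{\mathbb{D}}\!\left(\frac{\mu}{\psi_k(\zeta_{G})},\frac{\nu}{\psi_k(\zeta_{L})}\right)^{q_z(\nu,L,k)}\right\}\le\mathcal{M}_{\mathbb{D}}(\zeta_{L},\zeta_{G});$$ * or there is $\theta_z\in\mathbb{R}$ (which may depend on $k$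 and $z$) with $\{x\in\Omega: B_{k,z}(x)=e^{i\theta_z}\psi_k(\zeta_{G})\}\subseteq\sigma(W_{G})$ and $\{x\in\Omega: B_{k,z}(x)=e^{i\theta_z}\psi_k(\zeta_{L})\}\subseteq\sigma(W_{L})$. -/

import Mathlib

open Metric Set

noncomputable section

/-- The Moebius distance `|(z - w) / (1 - conj w * z)|` on the open unit disc. -/
def moebiusDist (z w : ℂ) : ℝ := ‖(z - w) / (1 - (starRingEnd ℂ) w * z)‖

/-- The Caratheodory pseudo-distance of `Ω` (normalised through the Moebius distance): the supremum
of `moebiusDist (f p) (f q)` over all holomorphic maps `f` from `Ω` to the open unit disc. -/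
def caratheodoryDist (Ω : Set ℂ) (p q : ℂ) : ℝ :=
  sSup {r : ℝ | ∃ f : ℂ → ℂ, DifferentiableOn ℂ f Ω ∧ MapsTo f Ω (ball 0 1) ∧
    r = moebiusDist (f p) (f q)}

/-- `Ω` is Caratheodory hyperbolic: the pseudo-distance `caratheodoryDist Ω` separates the points of
`Ω`, which is the only axiom of a metric that can fail for it. -/
def IsCaratheodoryHyperbolic (Ω : Set ℂ) : Prop :=
  ∀ p ∈ Ω, ∀ q ∈ Ω, caratheodoryDist Ω p q = 0 → p = q

/-- `g` is an extremal solution for the pair `(p, q)`: a holomorphic map from `Ω` to the open unit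
disc with `g p = 0` and `g q = caratheodoryDist Ω p q`. -/
def IsCaratheodoryExtremal (Ω : Set ℂ) (p q : ℂ) (g : ℂ → ℂ) : Prop :=
  DifferentiableOn ℂ g Ω ∧ MapsTo g Ω (ball 0 1) ∧ g p = 0 ∧
    g q = (caratheodoryDist Ω p q : ℂ)

theorem one_sub_conj_mul_ne_zero {a b : ℂ} (ha : ‖a‖ < 1) (hb : ‖b‖ < 1) :
    1 - (starRingEnd ℂ) b * a ≠ 0 := by
  intro h
  have h1 : (starRingEnd ℂ) b * a = 1 := (sub_eq_zero.1 h).symm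
  have h2 := congrArg norm h1
  rw [norm_mul, Complex.norm_conj, norm_one] at h2
  nlinarith [norm_nonneg a, norm_nonneg b]

theorem moebiusDist_lt_one {a b : ℂ} (ha : ‖a‖ < 1) (hb : ‖b‖ < 1) : moebiusDist a b < 1 := by
  have h0 := one_sub_conj_mul_ne_zero ha hb
  unfold moebiusDist
  rw [norm_div, div_lt_one (norm_pos_iff.2 h0)]
  refine lt_of_pow_lt_pow_left₀ 2 (norm_nonneg _) ?_
  have h1 : ‖1 - (starRingEnd ℂ) b * a‖ ^ 2 - ‖a - b‖ ^ 2
      = (1 - ‖a‖ ^ 2) * (1 - ‖b‖ ^ 2) := by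
    simp only [← Complex.normSq_eq_norm_sq, Complex.normSq_apply, Complex.sub_re, Complex.sub_im,
      Complex.mul_re, Complex.mul_im, Complex.conj_re, Complex.conj_im, Complex.one_re,
      Complex.one_im]
    ring
  have h2 : 0 < 1 - ‖a‖ ^ 2 := by nlinarith [norm_nonneg a]
  have h3 : 0 < 1 - ‖b‖ ^ 2 := by nlinarith [norm_nonneg b]
  nlinarith [mul_pos h2 h3]

theorem moebiusDist_comm (a b : ℂ) : moebiusDist a b = moebiusDist b a := by
  unfold moebiusDist
  rw [norm_div, norm_div, norm_sub_rev a b, ← Complex.norm_conj (1 - (starRingEnd ℂ) a * b)]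
  simp [mul_comm]

/-- A competitor for `caratheodoryDist Ω p q` can be normalised to vanish at `p`. -/
theorem exists_normalized {Ω : Set ℂ} {p q : ℂ} (hp : p ∈ Ω) {f : ℂ → ℂ}
    (hf : DifferentiableOn ℂ f Ω) (hm : MapsTo f Ω (ball 0 1)) :
    ∃ h : ℂ → ℂ, DifferentiableOn ℂ h Ω ∧ MapsTo h Ω (ball 0 1) ∧ h p = 0 ∧
      h q = (moebiusDist (f p) (f q) : ℂ) := by
  have hn : ∀ x ∈ Ω, ‖f x‖ < 1 := fun x hx => by simpa using hm hx
  let φ : ℂ → ℂ := fun x => (f x - f p) / (1 - (starRingEnd ℂ) (f p) * f x)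
  obtain ⟨c, hc, hcq⟩ : ∃ c : ℂ, ‖c‖ = 1 ∧ c * φ q = (‖φ q‖ : ℂ) := by
    by_cases h : φ q = 0
    · exact ⟨1, by simp, by simp [h]⟩
    · have h' : ((‖φ q‖ : ℝ) : ℂ) ≠ 0 := by simpa using h
      exact ⟨(‖φ q‖ : ℂ) / φ q, by simp [h], by field_simp⟩
  refine ⟨fun x => c * φ x, ?_, ?_, by simp [φ], ?_⟩
  · refine DifferentiableOn.const_mul (DifferentiableOn.div (hf.sub_const _) ?_ ?_) _
    · exact (hf.const_mul _).const_sub _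
    · exact fun x hx => one_sub_conj_mul_ne_zero (hn x hx) (hn p hp)
  · intro x hx
    have := moebiusDist_lt_one (hn x hx) (hn p hp)
    simp only [mem_ball_zero_iff, norm_mul, hc, one_mul]
    exact this
  · simp only [hcq]
    rw [moebiusDist_comm]; rfl

/-- Extremal solutions exist. -/
theorem exists_isCaratheodoryExtremal {Ω : Set ℂ} (hΩ : IsOpen Ω) (hc : IsConnected Ω) {p q : ℂ}
    (hp : p ∈ Ω) (hq : q ∈ Ω) : ∃ g, IsCaratheodoryExtremal Ω p q g := by
  let S : Set ℝ := {r : ℝ | ∃ f : ℂ → ℂ, DifferentiableOn ℂ f Ω ∧ MapsTo f Ω (ball 0 1) ∧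
    r = moebiusDist (f p) (f q)}
  have hne : S.Nonempty := ⟨_, fun _ => 0, differentiableOn_const _, fun x _ => by simp, rfl⟩
  have hbd : BddAbove S := by
    refine ⟨1, ?_⟩
    rintro r ⟨f, -, hm, rfl⟩
    exact (moebiusDist_lt_one (by simpa using hm hp) (by simpa using hm hq)).le
  obtain ⟨u, -, hu, huS⟩ := exists_seq_tendsto_sSup hne hbd
  have hex : ∀ k, ∃ h : ℂ → ℂ, DifferentiableOn ℂ h Ω ∧ MapsTo h Ω (ball 0 1) ∧ h p = 0 ∧
      h q = (u k : ℂ) := by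
    intro k
    obtain ⟨f, hf, hm, he⟩ := huS k
    rw [he]
    exact exists_normalized hp hf hm
  choose f hfd hfm hfp hfq using hex
  let U : Ultrafilter ℕ := Filter.hyperfilter ℕ
  have hlim : ∀ x, ∃ y : ℂ, x ∈ Ω → Filter.Tendsto (fun k => f k x) U (nhds y) := by
    intro x
    by_cases hx : x ∈ Ω
    · obtain ⟨y, -, hy⟩ := (isCompact_closedBall (0 : ℂ) 1).ultrafilter_le_nhds'
        (U.map fun k => f k x) (Filter.Eventually.of_forall
          (f := (U : Filter ℕ)) fun k => ball_subset_closedBall (hfm k hx))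
      exact ⟨y, fun _ => hy⟩
    · exact ⟨0, fun h => absurd h hx⟩
  choose g hg using hlim
  have hloc : TendstoLocallyUniformlyOn f g (U : Filter ℕ) Ω := by
    rw [Metric.tendstoLocallyUniformlyOn_iff]
    intro ε hε x hx
    obtain ⟨r, hr, hrΩ⟩ := Metric.isOpen_iff.1 hΩ x hx
    have hlip : ∀ k, ∀ y ∈ ball x r, dist (f k y) (f k x) ≤ 2 / r * dist y x := by
      intro k y hy
      refine Complex.dist_le_div_mul_dist_of_mapsTo_ball ((hfd k).mono hrΩ) ?_ hy
      intro w hw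
      have h1 : ‖f k w‖ < 1 := by simpa using hfm k (hrΩ hw)
      have h2 : ‖f k x‖ < 1 := by simpa using hfm k hx
      simp only [mem_closedBall, dist_eq_norm]
      linarith [norm_sub_le (f k w) (f k x)]
    have hglip : ∀ y ∈ ball x r, dist (g y) (g x) ≤ 2 / r * dist y x := fun y hy =>
      le_of_tendsto ((hg y (hrΩ hy)).dist (hg x hx)) (Filter.Eventually.of_forall fun k => hlip k y hy)
    have hδ : 0 < min r (r * ε / 8) := by positivity
    refine ⟨ball x (min r (r * ε / 8)), mem_nhdsWithin_of_mem_nhds (ball_mem_nhds x hδ), ?_⟩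
    filter_upwards [(Metric.tendsto_nhds.1 (hg x hx)) (ε / 4) (by positivity)] with k hk y hy
    have hy1 : y ∈ ball x r := ball_subset_ball (min_le_left _ _) hy
    have hy2 : dist y x < r * ε / 8 := lt_of_lt_of_le hy (min_le_right _ _)
    have hy3 : 2 / r * dist y x ≤ ε / 4 := by
      calc 2 / r * dist y x ≤ 2 / r * (r * ε / 8) := by gcongr
        _ = ε / 4 := by field_simp; norm_num
    have t1 := hlip k y hy1
    have t2 := hglip y hy1
    have t3 := dist_triangle4 (g y) (g x) (f k x) (f k y)
    rw [dist_comm (g x), dist_comm (f k x) (f k y)] at t3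
    linarith
  have hgd : DifferentiableOn ℂ g Ω := hloc.differentiableOn (Filter.Eventually.of_forall hfd) hΩ
  have hgp : g p = 0 := by
    refine tendsto_nhds_unique (hg p hp) ?_
    simp only [hfp]; exact tendsto_const_nhds
  have hg1 : ∀ x ∈ Ω, ‖g x‖ ≤ 1 := fun x hx =>
    le_of_tendsto (hg x hx).norm (Filter.Eventually.of_forall fun k =>
      (by simpa using hfm k hx : ‖f k x‖ < 1).le)
  refine ⟨g, hgd, fun x hx => ?_, hgp, ?_⟩
  · rw [mem_ball_zero_iff]
    refine lt_of_le_of_ne (hg1 x hx) fun h1 => ?_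
    have hmax : IsMaxOn (norm ∘ g) Ω x := fun y hy => by
      rw [mem_ofPred_eq, Function.comp_apply, Function.comp_apply, h1]; exact hg1 y hy
    have := Complex.eqOn_of_isPreconnected_of_isMaxOn_norm hc.isPreconnected hΩ hgd hx hmax hp
    rw [hgp, Function.const_apply] at this
    rw [← this] at h1; simp at h1
  · refine tendsto_nhds_unique (hg q hq) ?_
    simp only [hfq]
    have : Filter.Tendsto u (U : Filter ℕ) (nhds (sSup S)) :=
      hu.mono_left Nat.hyperfilter_le_atTop
    exact (Complex.continuous_ofReal.tendsto _).comp this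

/-- For `p ≠ q` two extremal solutions coincide on the domain. -/
theorem IsCaratheodoryExtremal.eqOn {Ω : Set ℂ} (hΩ : IsOpen Ω) (hc : IsConnected Ω) {p q : ℂ}
    (hp : p ∈ Ω) (hq : q ∈ Ω) (hpq : p ≠ q) {g₁ g₂ : ℂ → ℂ}
    (h₁ : IsCaratheodoryExtremal Ω p q g₁) (h₂ : IsCaratheodoryExtremal Ω p q g₂) :
    EqOn g₁ g₂ Ω := by
  obtain ⟨d₁, m₁, p₁, q₁⟩ := h₁
  obtain ⟨d₂, m₂, p₂, q₂⟩ := h₂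
  let h : ℂ → ℂ := fun x => (g₁ x + g₂ x) / 2
  let K : ℂ → ℂ := fun x => ((g₁ x - g₂ x) / 2) ^ 2
  have hhd : DifferentiableOn ℂ h Ω := (d₁.add d₂).div_const 2
  have hKd : DifferentiableOn ℂ K Ω := ((d₁.sub d₂).div_const 2).pow 2
  have hbound : ∀ x ∈ Ω, ‖h x‖ + ‖K x‖ / 2 < 1 := by
    intro x hx
    have n₁ : ‖g₁ x‖ < 1 := by simpa using m₁ hx
    have n₂ : ‖g₂ x‖ < 1 := by simpa using m₂ hx
    have hpar := parallelogram_law_with_norm ℝ (g₁ x) (g₂ x)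
    have e1 : ‖h x‖ = ‖g₁ x + g₂ x‖ / 2 := by simp [h]
    have e2 : ‖K x‖ = (‖g₁ x - g₂ x‖ / 2) ^ 2 := by simp [K]
    rw [e1, e2]
    nlinarith [norm_nonneg (g₁ x), norm_nonneg (g₂ x), norm_nonneg (g₁ x + g₂ x),
      norm_nonneg (g₁ x - g₂ x), sq_nonneg (‖g₁ x + g₂ x‖ / 2 - 1)]
  have hKp : K p = 0 := by simp [K, p₁, p₂]
  by_contra hne
  have hKa : AnalyticOnNhd ℂ K Ω := hKd.analyticOnNhd hΩ
  have hord : analyticOrderAt K q ≠ ⊤ := by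
    intro htop
    have hz := hKa.eqOn_zero_of_preconnected_of_eventuallyEq_zero hc.isPreconnected hq
      (analyticOrderAt_eq_top.1 htop)
    refine hne fun x hx => ?_
    have h0 : ((g₁ x - g₂ x) / 2) ^ 2 = 0 := hz hx
    have h1 : g₁ x - g₂ x = 0 := by simpa using h0
    exact sub_eq_zero.1 h1
  obtain ⟨N, hN⟩ := ENat.ne_top_iff_exists.1 hord
  obtain ⟨u, hu, hu0, hKu⟩ := ((hKa q hq).analyticOrderAt_eq_natCast).1 hN.symm
  classical
  let e : ℂ → ℂ := Function.update (fun x => K x / (x - q) ^ N) q (u q)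
  have heq : e q = u q := by simp [e]
  have hene : ∀ x, x ≠ q → e x = K x / (x - q) ^ N := fun x hx => by simp [e, hx]
  have hed : DifferentiableOn ℂ e Ω := by
    intro x hx
    refine DifferentiableAt.differentiableWithinAt ?_
    by_cases hxq : x = q
    · subst hxq
      refine hu.differentiableAt.congr_of_eventuallyEq ?_
      filter_upwards [hKu] with y hy
      by_cases hyx : y = x
      · rw [hyx, heq]
      · rw [hene y hyx, hy, smul_eq_mul]
        have : (y - x) ^ N ≠ 0 := pow_ne_zero _ (sub_ne_zero.2 hyx)
        field_simp
    · have : DifferentiableAt ℂ (fun x => K x / (x - q) ^ N) x :=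
        ((hKa x hx).differentiableAt).div (by fun_prop) (pow_ne_zero _ (sub_ne_zero.2 hxq))
      refine this.congr_of_eventuallyEq ?_
      filter_upwards [isOpen_ne.mem_nhds hxq] with y hy
      exact hene y hy
  obtain ⟨δ, hδ, hδΩ⟩ := Metric.nhds_basis_closedBall.mem_iff.1 (hΩ.mem_nhds hq)
  have hcpt := isCompact_closedBall q δ
  have hneB : (closedBall q δ).Nonempty := ⟨q, mem_closedBall_self hδ.le⟩
  obtain ⟨x₀, hx₀, hs⟩ := hcpt.exists_isMaxOn hneB (hhd.continuousOn.mono hδΩ).norm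
  obtain ⟨x₁, hx₁, hM⟩ := hcpt.exists_isMaxOn hneB (hed.continuousOn.mono hδΩ).norm
  have hs1 : ‖h x₀‖ < 1 := by
    have := hbound x₀ (hδΩ hx₀)
    linarith [norm_nonneg (K x₀)]
  let ε : ℝ := min (δ ^ N / 2) ((1 - ‖h x₀‖) / (‖e x₁‖ + 1))
  have hε : 0 < ε := lt_min (by positivity) (div_pos (by linarith) (by positivity))
  have hbound2 : ∀ x ∈ Ω, ‖h x‖ + ε * ‖e x‖ < 1 := by
    intro x hx
    by_cases hxδ : x ∈ closedBall q δ
    · have a1 : ‖h x‖ ≤ ‖h x₀‖ := hs hxδ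
      have a2 : ‖e x‖ ≤ ‖e x₁‖ := hM hxδ
      have a3 : ε * (‖e x₁‖ + 1) ≤ 1 - ‖h x₀‖ := by
        rw [← le_div_iff₀ (by positivity)]; exact min_le_right _ _
      nlinarith
    · have hd : δ < ‖x - q‖ := by simpa [dist_eq_norm] using hxδ
      have hxq : x ≠ q := by rintro rfl; simp at hd; linarith
      have a1 : ε ≤ δ ^ N / 2 := min_le_left _ _
      have a2 : δ ^ N ≤ ‖x - q‖ ^ N := pow_le_pow_left₀ hδ.le hd.le N
      have a3 : ε * ‖e x‖ ≤ ‖K x‖ / 2 := by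
        have e0 : ‖e x‖ = ‖K x‖ / ‖x - q‖ ^ N := by rw [hene x hxq, norm_div, norm_pow (x - q)]
        have : 0 < ‖x - q‖ ^ N := pow_pos (hδ.trans hd) N
        rw [e0, ← mul_div_assoc, div_le_iff₀ this]
        nlinarith [norm_nonneg (K x)]
      linarith [hbound x hx]
  have hun : (‖u q‖ : ℂ) ≠ 0 := by simpa using hu0
  let c : ℂ := (‖u q‖ : ℂ) / u q
  have hc1 : ‖c‖ = 1 := by simp [c, hu0]
  have hcu : c * u q = (‖u q‖ : ℂ) := by simp only [c]; field_simp
  let H : ℂ → ℂ := fun x => h x + (ε : ℂ) * (c * e x)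
  have hHd : DifferentiableOn ℂ H Ω := hhd.add ((hed.const_mul c).const_mul _)
  have hHm : MapsTo H Ω (ball 0 1) := by
    intro x hx
    rw [mem_ball_zero_iff]
    refine lt_of_le_of_lt (norm_add_le _ _) ?_
    rw [norm_mul, norm_mul, hc1, one_mul, Complex.norm_real, Real.norm_of_nonneg hε.le]
    exact hbound2 x hx
  have hHp : H p = 0 := by
    simp [H, h, p₁, p₂, hene p hpq, hKp]
  have hHq : H q = ((caratheodoryDist Ω p q + ε * ‖u q‖ : ℝ) : ℂ) := by
    simp only [H, h, q₁, q₂, heq, hcu]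
    push_cast; ring
  have hbd : BddAbove {r : ℝ | ∃ f : ℂ → ℂ, DifferentiableOn ℂ f Ω ∧ MapsTo f Ω (ball 0 1) ∧
      r = moebiusDist (f p) (f q)} := by
    refine ⟨1, ?_⟩
    rintro r ⟨f, -, hm, rfl⟩
    exact (moebiusDist_lt_one (by simpa using hm hp) (by simpa using hm hq)).le
  have hle : moebiusDist (H p) (H q) ≤ caratheodoryDist Ω p q := le_csSup hbd ⟨H, hHd, hHm, rfl⟩
  have hval : moebiusDist (H p) (H q) = |caratheodoryDist Ω p q + ε * ‖u q‖| := by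
    rw [hHp, hHq, moebiusDist]
    simp only [mul_zero, sub_zero, div_one, zero_sub, norm_neg, Complex.norm_real, Real.norm_eq_abs]
  have hpos : 0 < ε * ‖u q‖ := mul_pos hε (norm_pos_iff.2 hu0)
  linarith [le_abs_self (caratheodoryDist Ω p q + ε * ‖u q‖)]

open Classical in
/-- The extremal solution `G_Ω(p, q; ·)`. It exists for all `p`, `q` in a domain `Ω`
(`exists_isCaratheodoryExtremal`), and for `p ≠ q` in a Caratheodory hyperbolic domain its
restriction to `Ω` is unique (`IsCaratheodoryExtremal.eqOn`). Only its values on `Ω` matter. -/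
def caratheodoryExtremal (Ω : Set ℂ) (p q : ℂ) : ℂ → ℂ :=
  if h : ∃ g, IsCaratheodoryExtremal Ω p q g then h.choose else 0

/-- `S_n(Ω)`: the complex `n × n` matrices all of whose eigenvalues lie in `Ω`. -/
def matricialDomain (n : ℕ) (Ω : Set ℂ) : Set (Matrix (Fin n) (Fin n) ℂ) :=
  {A | spectrum ℂ A ⊆ Ω}

/-- The finite set of eigenvalues of `A`. -/
def specFinset {n : ℕ} (A : Matrix (Fin n) (Fin n) ℂ) : Finset ℂ :=
  (Matrix.finite_spectrum A).toFinset

/-- The multiplicity of `a` as a zero of the minimal polynomial of `A`. -/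
def minpolyMult {n : ℕ} (A : Matrix (Fin n) (Fin n) ℂ) (a : ℂ) : ℕ :=
  (minpoly ℂ A).rootMultiplicity a

/-- `P` has the same derivatives as `f` at every eigenvalue `a` of `A`, up to order one less than the
multiplicity of `a` as a zero of the minimal polynomial of `A`. -/
def IsHermiteInterpolant {n : ℕ} (f : ℂ → ℂ) (A : Matrix (Fin n) (Fin n) ℂ)
    (P : Polynomial ℂ) : Prop :=
  ∀ a ∈ spectrum ℂ A, ∀ j < minpolyMult A a,
    (Polynomial.derivative^[j] P).eval a = iteratedDeriv j f a

theorem mem_spectrum_iff_isRoot_minpoly {n : ℕ} (A : Matrix (Fin n) (Fin n) ℂ) (a : ℂ) :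
    a ∈ spectrum ℂ A ↔ (minpoly ℂ A).IsRoot a := by
  rw [← Matrix.spectrum_toLin', ← Matrix.minpoly_toLin', ← Module.End.hasEigenvalue_iff_isRoot,
    Module.End.hasEigenvalue_iff_mem_spectrum]

theorem eval_iterate_derivative_eq_taylor (P : Polynomial ℂ) (a : ℂ) (j : ℕ) :
    (Polynomial.derivative^[j] P).eval a = (j.factorial : ℂ) * (Polynomial.taylor a P).coeff j := by
  rw [Polynomial.taylor_coeff]
  have := congrArg (fun g => Polynomial.eval a (g P)) (Polynomial.factorial_smul_hasseDeriv (R := ℂ) j)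
  simpa using this.symm

theorem X_sub_C_pow_dvd_iff_taylor (P : Polynomial ℂ) (a : ℂ) (m : ℕ) :
    (Polynomial.X - Polynomial.C a) ^ m ∣ P ↔ ∀ j < m, (Polynomial.taylor a P).coeff j = 0 := by
  rw [← Polynomial.X_pow_dvd_iff, ← map_dvd_iff (Polynomial.taylorEquiv a)]
  have h : (Polynomial.taylorEquiv a) ((Polynomial.X - Polynomial.C a) ^ m)
      = (Polynomial.X : Polynomial ℂ) ^ m := by
    change Polynomial.taylor a _ = _
    rw [Polynomial.taylor_pow]; simp
  rw [h]; rfl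

/-- Interpolating polynomials exist. -/
theorem exists_isHermiteInterpolant {n : ℕ} (f : ℂ → ℂ) (A : Matrix (Fin n) (Fin n) ℂ) :
    ∃ P, IsHermiteInterpolant f A P := by
  have hco : Pairwise (Function.onFun IsCoprime (fun a : spectrum ℂ A => Ideal.span
      {(Polynomial.X - Polynomial.C (a : ℂ)) ^ minpolyMult A a})) := by
    intro a b hab
    rw [Function.onFun, Ideal.isCoprime_span_singleton_iff]
    exact (Polynomial.pairwise_coprime_X_sub_C Function.injective_id
      (Subtype.coe_injective.ne hab)).pow
  let x : ℂ → Polynomial ℂ := fun a => Polynomial.taylor (-a)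
    (∑ j ∈ Finset.range (minpolyMult A a),
      Polynomial.C (iteratedDeriv j f a / j.factorial) * Polynomial.X ^ j)
  obtain ⟨P, hP⟩ := Ideal.exists_forall_sub_mem_ideal hco (fun a => x a)
  refine ⟨P, fun a ha j hj => ?_⟩
  have h1 := (X_sub_C_pow_dvd_iff_taylor _ _ _).1 (Ideal.mem_span_singleton.1 (hP ⟨a, ha⟩)) j hj
  rw [map_sub, Polynomial.coeff_sub, sub_eq_zero] at h1
  rw [eval_iterate_derivative_eq_taylor, h1]
  simp only [x, Polynomial.taylor_taylor, add_neg_cancel, Polynomial.taylor_zero,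
    Polynomial.finsetSum_coeff, Polynomial.coeff_C_mul_X_pow]
  rw [Finset.sum_eq_single j]
  · have : (j.factorial : ℂ) ≠ 0 := by exact_mod_cast j.factorial_ne_zero
    simp; field_simp
  · intro b _ hb; simp [hb.symm]
  · intro h; exact absurd (Finset.mem_range.2 hj) h

/-- The value of an interpolating polynomial at `A` does not depend on the polynomial. -/
theorem IsHermiteInterpolant.aeval_eq {n : ℕ} {f : ℂ → ℂ} {A : Matrix (Fin n) (Fin n) ℂ}
    {P Q : Polynomial ℂ} (hP : IsHermiteInterpolant f A P) (hQ : IsHermiteInterpolant f A Q) :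
    Polynomial.aeval A P = Polynomial.aeval A Q := by
  rw [← sub_eq_zero, ← map_sub, ← minpoly.dvd_iff]
  have hmon : (minpoly ℂ A).Monic := minpoly.monic (Matrix.isIntegral A)
  have hsp : (minpoly ℂ A).Splits := IsAlgClosed.splits _
  rw [hsp.eq_prod_roots_of_monic hmon, Finset.prod_multiset_map_count]
  refine Finset.prod_dvd_of_coprime ?_ ?_
  · intro a _ b _ hab
    exact (Polynomial.pairwise_coprime_X_sub_C Function.injective_id hab).pow
  · intro a ha
    rw [Polynomial.count_roots, X_sub_C_pow_dvd_iff_taylor]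
    intro j hj
    have hroot : a ∈ spectrum ℂ A := by
      rw [mem_spectrum_iff_isRoot_minpoly]
      exact Polynomial.isRoot_of_mem_roots (Multiset.mem_toFinset.1 ha)
    have h := (hP a hroot j hj).trans (hQ a hroot j hj).symm
    rw [eval_iterate_derivative_eq_taylor, eval_iterate_derivative_eq_taylor] at h
    have h0 : (j.factorial : ℂ) ≠ 0 := by exact_mod_cast j.factorial_ne_zero
    rw [map_sub, Polynomial.coeff_sub, sub_eq_zero]
    exact mul_left_cancel₀ h0 h

/-- The holomorphic functional calculus `f(A)`, for `f` holomorphic near the spectrum of `A`: the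
value at `A` of any polynomial that interpolates `f` on the spectrum of `A`. -/
def holoFC {n : ℕ} (f : ℂ → ℂ) (A : Matrix (Fin n) (Fin n) ℂ) : Matrix (Fin n) (Fin n) ℂ :=
  Polynomial.aeval A (exists_isHermiteInterpolant f A).choose

/-- The generalised minimal Blaschke product `B(A, z; ·)`: the product of the extremal solutions
`G_Ω(a, z; ·)` over the eigenvalues `a` of `A`, each raised to the multiplicity of `a` as a zero of
the minimal polynomial of `A`. -/
def genMinBlaschke {n : ℕ} (Ω : Set ℂ) (A : Matrix (Fin n) (Fin n) ℂ) (z : ℂ) : ℂ → ℂ :=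
  fun x => ∏ a ∈ specFinset A, caratheodoryExtremal Ω a z x ^ minpolyMult A a

open Classical in
/-- The exponent `q(ν)` attached to a holomorphic function `B` and a matrix `A`: the maximum of
`⌊(m(a) - 1) / (ord_a B' + 1)⌋ + 1` over the eigenvalues `a` of `A` with `B a = ν`, where `m(a)`
is the multiplicity of `a` as a zero of the minimal polynomial of `A`. -/
def blaschkeExponent {n : ℕ} (B : ℂ → ℂ) (A : Matrix (Fin n) (Fin n) ℂ) (ν : ℂ) : ℕ :=
  ((specFinset A).filter fun a => B a = ν).sup fun a =>
    (minpolyMult A a - 1) / (analyticOrderNatAt (deriv B) a + 1) + 1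

/-- The automorphism `ζ ↦ (ζ - a) / (1 - conj a * ζ)` of the unit disc. -/
def discAut (a ζ : ℂ) : ℂ := (ζ - a) / (1 - (starRingEnd ℂ) a * ζ)

theorem erase_nonempty (k : Fin 3) : ((Finset.univ : Finset (Fin 3)).erase k).Nonempty := by
  revert k; decide

/-- The larger of the two indices different from `k`. -/
def otherMax (k : Fin 3) : Fin 3 := (Finset.univ.erase k).max' (erase_nonempty k)

/-- The smaller of the two indices different from `k`. -/
def otherMin (k : Fin 3) : Fin 3 := (Finset.univ.erase k).min' (erase_nonempty k)

end

/-!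
Write `B` for `genMinBlaschke Ω (W k) z`, a holomorphic map from `Ω` to the disc that vanishes at each
eigenvalue of `W k` to at least its multiplicity in the minimal polynomial.

The matrices `B (F ζ)` depend holomorphically on `ζ` (`differentiableOn_holoFC`, from a Cauchy formula
for the functional calculus), their spectra `B '' σ (F ζ)` lie in the disc, and `B (F ζ_k) = 0`. Hence
`B (F ζ) = ψ ζ • E ζ` with `E` holomorphic and `ψ = discAut ζ_k`. By the Schwarz lemma for the spectral
unit ball (`norm_le_one_of_mem_spectrum`) all eigenvalues of all `E ζ` have modulus at most `1`.

Suppose some `E ζ` has a unimodular eigenvalue `c`. By Hurwitz's theorem `c` is an eigenvalue of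
every `E ζ` (`mem_spectrum_of_norm_eq_one`), so `c ψ(ζ)` always has a preimage under `B` in
`σ (F ζ)`. Solving `B x = c ψ(ζ)` for `ζ = τ x` gives the function `det (x - F (τ x))` on the domain
`Ω`, with uncountably many zeros; it vanishes identically, so that every preimage lies in `σ (F ζ)`
(`mem_spectrum_of_apply_eq`). This is the second alternative.

Otherwise every `E ζ` has its spectrum in the open disc. A second use of the Schwarz lemma, for `b (E ζ)`
with `b` a Blaschke product that annihilates `E ζ_G`, gives the inequality between the values at
`ζ_L` and `ζ_G` (`prod_moebiusDist_le`). The exponents suffice because `B - B λ` vanishes at `λ` to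
order `ord_λ B' + 1`, so that a Jordan block of size `m` of `W_G` at `λ` turns into blocks of size
at most `⌈m / (ord_λ B' + 1)⌉` of `B (W_G)` (`minpolyMult_le_blaschkeExponent`).
-/

/-! ### Circle integrals depending on a parameter -/

/-- A circle integral depends holomorphically on a parameter in which the integrand is holomorphic.
The derivative of the integrand in the parameter is bounded by Cauchy's estimate, and is measurable
along the circle as a limit of difference quotients. -/
theorem differentiableOn_circleIntegral_param {U : Set ℂ} (hU : IsOpen U) {φ : ℂ → ℂ → ℂ} {c : ℂ}
    {R : ℝ} (hR : 0 ≤ R) (hc : ContinuousOn (Function.uncurry φ) (U ×ˢ sphere c R))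
    (hd : ∀ w ∈ sphere c R, DifferentiableOn ℂ (fun z => φ z w) U) :
    DifferentiableOn ℂ (fun z => ∮ w in C(c, R), φ z w) U := by
  intro z₀ hz₀
  obtain ⟨r, hr, hrU⟩ := Metric.nhds_basis_closedBall.mem_iff.1 (hU.mem_nhds hz₀)
  have hcs : ∀ θ, circleMap c R θ ∈ sphere c R := fun θ => circleMap_mem_sphere c hR θ
  obtain ⟨M, hM⟩ := ((isCompact_closedBall z₀ r).prod (isCompact_sphere c R)).exists_bound_of_continuousOn
    (hc.mono (prod_mono hrU subset_rfl))
  have hM' : ∀ z ∈ closedBall z₀ r, ∀ w ∈ sphere c R, ‖φ z w‖ ≤ M :=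
    fun z hz w hw => hM (z, w) ⟨hz, hw⟩
  have hcont : ∀ z ∈ U, Continuous fun θ => deriv (circleMap c R) θ • φ z (circleMap c R θ) := by
    intro z hz
    have h1 : Continuous fun θ => deriv (circleMap c R) θ := by
      simp only [deriv_circleMap]; fun_prop
    exact h1.smul (hc.comp_continuous (f := fun θ => (z, circleMap c R θ)) (by fun_prop)
      fun θ => ⟨hz, hcs θ⟩)
  have hball : ∀ z ∈ ball z₀ (r / 2), closedBall z (r / 2) ⊆ closedBall z₀ r := by
    intro z hz x hx
    have h1 := mem_closedBall.1 hx
    have h2 := mem_ball.1 hz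
    exact mem_closedBall.2 (by linarith [dist_triangle x z z₀])
  have hzU : ∀ z ∈ ball z₀ (r / 2), z ∈ U := fun z hz =>
    hrU (hball z hz (mem_closedBall_self (by positivity)))
  have hderiv : ∀ θ, ∀ z ∈ ball z₀ (r / 2),
      HasDerivAt (fun z => deriv (circleMap c R) θ • φ z (circleMap c R θ))
        (deriv (circleMap c R) θ • deriv (fun z => φ z (circleMap c R θ)) z) z := fun θ z hz =>
    (((hd _ (hcs θ)).differentiableAt (hU.mem_nhds (hzU z hz))).hasDerivAt).fun_const_smul _
  have hz₀' : z₀ ∈ ball z₀ (r / 2) := mem_ball_self (by positivity)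
  refine DifferentiableAt.differentiableWithinAt ?_
  refine (intervalIntegral.hasDerivAt_integral_of_dominated_loc_of_deriv_le
    (F := fun z θ => deriv (circleMap c R) θ • φ z (circleMap c R θ))
    (F' := fun z θ => deriv (circleMap c R) θ • deriv (fun z => φ z (circleMap c R θ)) z)
    (bound := fun _ => R * (M / (r / 2))) (s := ball z₀ (r / 2))
    (isOpen_ball.mem_nhds hz₀') ?_ ?_ ?_ ?_ ?_ ?_).2.differentiableAt
  · filter_upwards [isOpen_ball.mem_nhds hz₀'] with z hz
    exact (hcont z (hzU z hz)).aestronglyMeasurable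
  · exact (hcont z₀ hz₀).intervalIntegrable _ _
  · let u : ℕ → ℂ := fun k => ((r / 4 * (1 / ((k : ℝ) + 1)) : ℝ) : ℂ)
    have hu0 : ∀ k, u k ≠ 0 := fun k => by
      simp only [u]; exact_mod_cast (by positivity : r / 4 * (1 / ((k : ℝ) + 1)) ≠ 0)
    have hulim : Filter.Tendsto u Filter.atTop (nhds 0) := by
      have h1 := (tendsto_one_div_add_atTop_nhds_zero_nat (𝕜 := ℝ)).const_mul (r / 4)
      rw [mul_zero] at h1
      have := (Complex.continuous_ofReal.tendsto 0).comp h1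
      rwa [Complex.ofReal_zero] at this
    have huU : ∀ k, z₀ + u k ∈ U := by
      intro k
      refine hrU ?_
      have h1 : 1 / ((k : ℝ) + 1) ≤ 1 := by
        rw [div_le_one (by positivity)]; linarith [k.cast_nonneg (α := ℝ)]
      have h2 : 0 ≤ r / 4 * (1 / ((k : ℝ) + 1)) := by positivity
      simp only [mem_closedBall, dist_eq_norm, add_sub_cancel_left, u, Complex.norm_real,
        Real.norm_of_nonneg h2]
      nlinarith
    refine aestronglyMeasurable_of_tendsto_ae Filter.atTop
      (f := fun k θ => (u k)⁻¹ • (deriv (circleMap c R) θ • φ (z₀ + u k) (circleMap c R θ)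
        - deriv (circleMap c R) θ • φ z₀ (circleMap c R θ))) (fun k => ?_) ?_
    · exact (((hcont _ (huU k)).sub (hcont _ hz₀)).const_smul (u k)⁻¹).aestronglyMeasurable
    · refine Filter.Eventually.of_forall fun θ => ?_
      have := (hasDerivAt_iff_tendsto_slope_zero.1 (hderiv θ z₀ hz₀'))
      exact this.comp (tendsto_nhdsWithin_iff.2 ⟨hulim, Filter.Eventually.of_forall hu0⟩)
  · refine Filter.Eventually.of_forall fun θ _ z hz => ?_
    rw [norm_smul]
    have h1 : ‖deriv (circleMap c R) θ‖ = R := by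
      simp [deriv_circleMap, abs_of_nonneg hR]
    rw [h1]
    refine mul_le_mul_of_nonneg_left ?_ hR
    refine Complex.norm_deriv_le_of_forall_mem_sphere_norm_le (by positivity) ?_ ?_
    · refine DifferentiableOn.diffContOnCl ?_
      exact (hd _ (hcs θ)).mono fun x hx => hrU (hball z hz (closure_ball_subset_closedBall hx))
    · exact fun x hx => hM' x (hball z hz (sphere_subset_closedBall hx)) _ (hcs θ)
  · exact intervalIntegrable_const
  · exact Filter.Eventually.of_forall fun θ _ z hz => hderiv θ z hz

/-! ### Matrices depending on a parameter -/

theorem mem_spectrum_iff_det {n : ℕ} (A : Matrix (Fin n) (Fin n) ℂ) (c : ℂ) :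
    c ∈ spectrum ℂ A ↔ (Matrix.scalar (Fin n) c - A).det = 0 := by
  rw [spectrum.mem_iff, Matrix.isUnit_iff_isUnit_det, isUnit_iff_ne_zero, not_not]
  rfl

theorem mem_spectrum_of_det_one_sub {n : ℕ} {A : Matrix (Fin n) (Fin n) ℂ} {t : ℂ} (ht : t ≠ 0)
    (h : (1 - t • A).det = 0) : t⁻¹ ∈ spectrum ℂ A := by
  have e : Matrix.scalar (Fin n) t⁻¹ - A = t⁻¹ • (1 - t • A) := by
    rw [smul_sub, smul_smul, inv_mul_cancel₀ ht, one_smul]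
    congr 1
    ext i j; simp [Matrix.diagonal_apply, Matrix.one_apply]
  rw [mem_spectrum_iff_det, e, Matrix.det_smul, h, mul_zero]

theorem det_one_sub_eq_zero {n : ℕ} {A : Matrix (Fin n) (Fin n) ℂ} {c : ℂ} (hc : c ≠ 0)
    (h : c ∈ spectrum ℂ A) : (1 - c⁻¹ • A).det = 0 := by
  have e : 1 - c⁻¹ • A = c⁻¹ • (Matrix.scalar (Fin n) c - A) := by
    rw [smul_sub]
    congr 1
    ext i j; by_cases hij : i = j <;> simp [Matrix.one_apply, hij, hc]
  rw [e, Matrix.det_smul, (mem_spectrum_iff_det A c).1 h, mul_zero]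

theorem smul_mem_spectrum_smul {n : ℕ} {A : Matrix (Fin n) (Fin n) ℂ} {c : ℂ} (t : ℂ)
    (h : c ∈ spectrum ℂ A) : t * c ∈ spectrum ℂ (t • A) := by
  have e : Matrix.scalar (Fin n) (t * c) - t • A = t • (Matrix.scalar (Fin n) c - A) := by
    rw [smul_sub]
    congr 1
    ext i j; by_cases hij : i = j <;> simp [hij]
  rw [mem_spectrum_iff_det] at h ⊢
  rw [e, Matrix.det_smul, h]
  -- For `n = 0` the determinant is `1`, so that `h` is impossible.
  rcases n with - | n
  · simp at h
  · simp

theorem spectrum_nonempty {n : ℕ} (hn : n ≠ 0) (A : Matrix (Fin n) (Fin n) ℂ) :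
    (spectrum ℂ A).Nonempty := by
  have : NeZero n := ⟨hn⟩
  exact spectrum.nonempty_of_isAlgClosed_of_finiteDimensional ℂ A

theorem norm_le_sum_of_mem_spectrum {n : ℕ} {A : Matrix (Fin n) (Fin n) ℂ} {c : ℂ}
    (h : c ∈ spectrum ℂ A) : ‖c‖ ≤ ∑ i, ∑ j, ‖A i j‖ := by
  rw [← Matrix.spectrum_toLin', ← Module.End.hasEigenvalue_iff_mem_spectrum] at h
  obtain ⟨k, hk⟩ := eigenvalue_mem_ball h
  rw [mem_closedBall, dist_eq_norm] at hk
  have h1 : ‖c‖ ≤ ∑ j, ‖A k j‖ := by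
    rw [← Finset.add_sum_erase _ _ (Finset.mem_univ k)]
    have := norm_add_le (c - A k k) (A k k)
    rw [sub_add_cancel] at this
    linarith
  exact h1.trans (Finset.single_le_sum (f := fun i => ∑ j, ‖A i j‖)
    (fun i _ => Finset.sum_nonneg fun j _ => norm_nonneg _) (Finset.mem_univ k))

theorem differentiableOn_det {n : ℕ} {U : Set ℂ} {M : ℂ → Matrix (Fin n) (Fin n) ℂ}
    (h : ∀ i j, DifferentiableOn ℂ (fun x => M x i j) U) :
    DifferentiableOn ℂ (fun x => (M x).det) U := by
  simp only [Matrix.det_apply]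
  exact DifferentiableOn.fun_sum fun σ _ =>
    (DifferentiableOn.fun_finsetProd fun i _ => h _ _).const_smul _

theorem differentiableOn_adjugate {n : ℕ} {U : Set ℂ} {M : ℂ → Matrix (Fin n) (Fin n) ℂ}
    (h : ∀ i j, DifferentiableOn ℂ (fun x => M x i j) U) (i j : Fin n) :
    DifferentiableOn ℂ (fun x => (M x).adjugate i j) U := by
  simp only [Matrix.adjugate_apply]
  refine differentiableOn_det fun a b => ?_
  simp only [Matrix.updateRow_apply]
  by_cases hab : a = j
  · simp only [hab, if_true]; exact differentiableOn_const _
  · simp only [hab, if_false]; exact h a b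

theorem continuousOn_of_entries {n : ℕ} {X : Type*} [TopologicalSpace X] {U : Set X}
    {M : X → Matrix (Fin n) (Fin n) ℂ} (h : ∀ i j, ContinuousOn (fun x => M x i j) U) :
    ContinuousOn M U :=
  continuousOn_pi.2 fun i => continuousOn_pi.2 fun j => h i j

theorem ContinuousOn.entry {n : ℕ} {X : Type*} [TopologicalSpace X] {U : Set X}
    {M : X → Matrix (Fin n) (Fin n) ℂ} (h : ContinuousOn M U) (i j : Fin n) :
    ContinuousOn (fun x => M x i j) U :=
  continuousOn_pi.1 (continuousOn_pi.1 h i) j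

theorem ContinuousOn.det {n : ℕ} {X : Type*} [TopologicalSpace X] {U : Set X}
    {M : X → Matrix (Fin n) (Fin n) ℂ} (h : ContinuousOn M U) :
    ContinuousOn (fun x => (M x).det) U :=
  (Continuous.matrix_det continuous_id).comp_continuousOn h

theorem ContinuousOn.adjugate {n : ℕ} {X : Type*} [TopologicalSpace X] {U : Set X}
    {M : X → Matrix (Fin n) (Fin n) ℂ} (h : ContinuousOn M U) :
    ContinuousOn (fun x => (M x).adjugate) U :=
  (Continuous.matrix_adjugate continuous_id).comp_continuousOn h

/-! ### The holomorphic functional calculus -/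

theorem iteratedDeriv_eval_polynomial (P : Polynomial ℂ) (j : ℕ) :
    iteratedDeriv j (fun x => P.eval x) = fun x => (Polynomial.derivative^[j] P).eval x := by
  induction j with
  | zero => simp
  | succ j ih =>
    rw [iteratedDeriv_succ, ih, Function.iterate_succ_apply']
    ext x
    exact Polynomial.deriv _

theorem analyticAt_eval_polynomial (P : Polynomial ℂ) (a : ℂ) :
    AnalyticAt ℂ (fun x => P.eval x) a :=
  P.differentiable.analyticAt a

/-- Interpolation to order `m` at `a` says that the difference vanishes to order `m` at `a`. -/
theorem interpolates_iff_le_analyticOrderAt {f : ℂ → ℂ} {a : ℂ} (hf : AnalyticAt ℂ f a)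
    (P : Polynomial ℂ) (m : ℕ) :
    (∀ j < m, (Polynomial.derivative^[j] P).eval a = iteratedDeriv j f a) ↔
      (m : ℕ∞) ≤ analyticOrderAt (fun x => f x - P.eval x) a := by
  have hP := analyticAt_eval_polynomial P a
  rw [natCast_le_analyticOrderAt_iff_iteratedDeriv_eq_zero (hf.fun_sub hP)]
  refine forall₂_congr fun j _ => ?_
  rw [iteratedDeriv_fun_sub hf.contDiffAt hP.contDiffAt, iteratedDeriv_eval_polynomial,
    sub_eq_zero, eq_comm]

theorem holoFC_eq_aeval {n : ℕ} {f : ℂ → ℂ} {A : Matrix (Fin n) (Fin n) ℂ} {P : Polynomial ℂ}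
    (hP : IsHermiteInterpolant f A P) : holoFC f A = Polynomial.aeval A P :=
  IsHermiteInterpolant.aeval_eq (exists_isHermiteInterpolant f A).choose_spec hP

theorem minpolyMult_pos {n : ℕ} {A : Matrix (Fin n) (Fin n) ℂ} {a : ℂ}
    (ha : a ∈ spectrum ℂ A) : 0 < minpolyMult A a :=
  (Polynomial.rootMultiplicity_pos (minpoly.ne_zero (Matrix.isIntegral A))).2
    ((mem_spectrum_iff_isRoot_minpoly A a).1 ha)

theorem IsHermiteInterpolant.eval_eq {n : ℕ} {f : ℂ → ℂ} {A : Matrix (Fin n) (Fin n) ℂ}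
    {P : Polynomial ℂ} (hP : IsHermiteInterpolant f A P) {a : ℂ} (ha : a ∈ spectrum ℂ A) :
    P.eval a = f a := by
  simpa using hP a ha 0 (minpolyMult_pos ha)

/-- The spectral mapping theorem for the holomorphic functional calculus. -/
theorem spectrum_holoFC {n : ℕ} (hn : n ≠ 0) (f : ℂ → ℂ) (A : Matrix (Fin n) (Fin n) ℂ) :
    spectrum ℂ (holoFC f A) = f '' spectrum ℂ A := by
  obtain ⟨P, hP⟩ := exists_isHermiteInterpolant f A
  rw [holoFC_eq_aeval hP, spectrum.map_polynomial_aeval_of_nonempty A P (spectrum_nonempty hn A)]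
  exact image_congr fun a ha => hP.eval_eq ha

theorem holoFC_eq_zero {n : ℕ} {f : ℂ → ℂ} {A : Matrix (Fin n) (Fin n) ℂ}
    (hf : ∀ a ∈ spectrum ℂ A, AnalyticAt ℂ f a)
    (ho : ∀ a ∈ spectrum ℂ A, (minpolyMult A a : ℕ∞) ≤ analyticOrderAt f a) :
    holoFC f A = 0 := by
  have : IsHermiteInterpolant f A 0 := fun a ha =>
    (interpolates_iff_le_analyticOrderAt (hf a ha) 0 _).2 (by simpa using ho a ha)
  rw [holoFC_eq_aeval this, map_zero]

/-- Integrals over circles of the difference quotients `(p(X) - p(w)) / (X - w)` of a polynomial `p`,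
taken coefficientwise, form a polynomial; linear functionals commute with the integral. -/
theorem exists_polynomial_circleIntegral_divByMonic (S : Finset ℂ) {ρ : ℝ} (hρ : 0 ≤ ρ)
    (p : Polynomial ℂ) {g : ℂ → ℂ} (hg : ∀ a ∈ S, ContinuousOn g (sphere a ρ)) :
    ∃ r : Polynomial ℂ, ∀ l : Polynomial ℂ →ₗ[ℂ] ℂ,
      l r = ∑ a ∈ S, ∮ w in C(a, ρ), g w * l (p /ₘ (Polynomial.X - Polynomial.C w)) := by
  let N := p.natDegree + 1
  let co : ℕ → ℂ → ℂ := fun j w => (p /ₘ (Polynomial.X - Polynomial.C w)).coeff j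
  have hco : ∀ j, Continuous (co j) := by
    intro j
    simp only [co, Polynomial.coeff_divByMonic_X_sub_C]
    fun_prop
  refine ⟨∑ j ∈ Finset.range N, Polynomial.C (∑ a ∈ S, ∮ w in C(a, ρ), g w * co j w)
    * Polynomial.X ^ j, fun l => ?_⟩
  have hl : ∀ w, l (p /ₘ (Polynomial.X - Polynomial.C w))
      = ∑ j ∈ Finset.range N, co j w * l (Polynomial.X ^ j) := by
    intro w
    have hdeg : (p /ₘ (Polynomial.X - Polynomial.C w)).natDegree < N := by
      rw [Polynomial.natDegree_divByMonic p (Polynomial.monic_X_sub_C w)]; omega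
    conv_lhs => rw [Polynomial.as_sum_range_C_mul_X_pow' _ hdeg]
    simp only [map_sum, ← Polynomial.smul_eq_C_mul, map_smul, smul_eq_mul, co]
  simp only [hl, Finset.mul_sum, map_sum, ← Polynomial.smul_eq_C_mul, map_smul, smul_eq_mul,
    Finset.sum_mul]
  rw [Finset.sum_comm]
  refine Finset.sum_congr rfl fun a ha => ?_
  have hint : ∀ j, ContinuousOn (fun w => g w * co j w) (sphere a ρ) := fun j =>
    (hg a ha).mul (hco j).continuousOn
  rw [circleIntegral.integral_fun_sum]
  · refine Finset.sum_congr rfl fun j _ => ?_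
    rw [mul_comm, ← smul_eq_mul, ← circleIntegral.integral_smul]
    congr 1; ext w; simp only [smul_eq_mul]; ring
  · intro j _
    simp only [← mul_assoc]
    exact ((hint j).mul continuousOn_const).circleIntegrable hρ

theorem eval_divByMonic_X_sub_C (p : Polynomial ℂ) {w x : ℂ} (h : x ≠ w) :
    (p /ₘ (Polynomial.X - Polynomial.C w)).eval x = (p.eval x - p.eval w) / (x - w) := by
  have h1 := congrArg (Polynomial.eval x) (Polynomial.X_sub_C_mul_divByMonic_eq_sub_modByMonic p w)
  rw [Polynomial.modByMonic_X_sub_C_eq_C_eval] at h1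
  simp only [Polynomial.eval_mul, Polynomial.eval_sub, Polynomial.eval_X, Polynomial.eval_C] at h1
  rw [eq_div_iff (sub_ne_zero.2 h), mul_comm, h1]

/-- By the Cayley-Hamilton theorem the difference quotient of the characteristic polynomial,
evaluated at the matrix, is the adjugate of the characteristic matrix. -/
theorem aeval_charpoly_divByMonic_X_sub_C {n : ℕ} (A : Matrix (Fin n) (Fin n) ℂ) {w : ℂ}
    (hw : (Matrix.scalar (Fin n) w - A).det ≠ 0) :
    Polynomial.aeval A (A.charpoly /ₘ (Polynomial.X - Polynomial.C w))
      = (Matrix.scalar (Fin n) w - A).adjugate := by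
  have h1 := congrArg (Polynomial.aeval A)
    (Polynomial.X_sub_C_mul_divByMonic_eq_sub_modByMonic A.charpoly w)
  rw [Polynomial.modByMonic_X_sub_C_eq_C_eval, map_mul, map_sub, map_sub, Matrix.aeval_self_charpoly,
    Polynomial.aeval_X, Polynomial.aeval_C, Polynomial.aeval_C, Matrix.eval_charpoly, zero_sub] at h1
  have h2 : (Matrix.scalar (Fin n) w - A)
      * Polynomial.aeval A (A.charpoly /ₘ (Polynomial.X - Polynomial.C w))
      = (Matrix.scalar (Fin n) w - A).det • 1 := by
    have e : Matrix.scalar (Fin n) w - A = -(A - algebraMap ℂ (Matrix (Fin n) (Fin n) ℂ) w) :=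
      (neg_sub A (algebraMap ℂ (Matrix (Fin n) (Fin n) ℂ) w)).symm
    rw [← Algebra.algebraMap_eq_smul_one, ← neg_eq_iff_eq_neg.2 h1, ← neg_mul, e]
  have h3 := congrArg (fun M => (Matrix.scalar (Fin n) w - A).adjugate * M) h2
  simp only [← mul_assoc, Matrix.adjugate_mul, smul_mul_assoc, one_mul, mul_smul_comm, mul_one] at h3
  exact smul_right_injective _ hw h3

theorem minpolyMult_le_rootMultiplicity_charpoly {n : ℕ} (A : Matrix (Fin n) (Fin n) ℂ) (a : ℂ) :
    minpolyMult A a ≤ A.charpoly.rootMultiplicity a :=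
  Polynomial.rootMultiplicity_le_rootMultiplicity_of_dvd A.charpoly_monic.ne_zero
    (Matrix.minpoly_dvd_charpoly A) a

/-- A polynomial vanishes at `a` to analytic order at least any `m ≤ rootMultiplicity`, also after
multiplication by an analytic function. -/
theorem le_analyticOrderAt_eval_mul {p : Polynomial ℂ} {a : ℂ} {m : ℕ} {h : ℂ → ℂ}
    (hm : m ≤ p.rootMultiplicity a) (hh : AnalyticAt ℂ h a) :
    (m : ℕ∞) ≤ analyticOrderAt (fun x => p.eval x * h x) a := by
  obtain ⟨q, hq⟩ := (pow_dvd_pow _ hm).trans (p.pow_rootMultiplicity_dvd a)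
  rw [natCast_le_analyticOrderAt ((analyticAt_eval_polynomial p a).fun_mul hh)]
  refine ⟨fun x => q.eval x * h x, (analyticAt_eval_polynomial q a).mul hh, ?_⟩
  refine Filter.Eventually.of_forall fun x => ?_
  conv_lhs => rw [hq]
  simp [mul_assoc]

/-- Cauchy's integral formula for the holomorphic functional calculus, over small circles that
enclose the spectrum. The interpolating polynomial is Hermite's, with nodes the zeros of the
characteristic polynomial. -/
theorem holoFC_apply_eq_sum_circleIntegral {n : ℕ} {Ω : Set ℂ} {f : ℂ → ℂ}
    (hf : DifferentiableOn ℂ f Ω) {S : Finset ℂ} {ρ : ℝ} (hρ : 0 < ρ)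
    (hS : ∀ a ∈ S, closedBall a ρ ⊆ Ω)
    (hdisj : (S : Set ℂ).PairwiseDisjoint fun a => closedBall a ρ)
    {A : Matrix (Fin n) (Fin n) ℂ} (hA : ∀ x ∈ spectrum ℂ A, ∃ a ∈ S, x ∈ ball a ρ) (i j : Fin n) :
    holoFC f A i j = ∑ a ∈ S, ∮ w in C(a, ρ),
      ((2 * Real.pi * Complex.I)⁻¹ * f w / (Matrix.scalar (Fin n) w - A).det)
        * (Matrix.scalar (Fin n) w - A).adjugate i j := by
  set κ : ℂ := (2 * Real.pi * Complex.I)⁻¹ with hκ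
  have hκ0 : κ * (2 * Real.pi * Complex.I) = 1 := inv_mul_cancel₀ Complex.two_pi_I_ne_zero
  let p := A.charpoly
  have hpe : ∀ w, p.eval w = (Matrix.scalar (Fin n) w - A).det := fun w => A.eval_charpoly w
  have hout : ∀ a ∈ S, ∀ w ∈ sphere a ρ, ∀ b ∈ S, w ∉ ball b ρ := by
    intro a ha w hw b hb hwb
    by_cases hab : a = b
    · subst hab; exact (mem_ball.1 hwb).ne (mem_sphere.1 hw)
    · exact disjoint_left.1 (hdisj ha hb hab) (sphere_subset_closedBall hw)
        (ball_subset_closedBall hwb)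
  have hp0 : ∀ a ∈ S, ∀ w ∈ sphere a ρ, p.eval w ≠ 0 := by
    intro a ha w hw h0
    rw [hpe, ← mem_spectrum_iff_det] at h0
    obtain ⟨b, hb, hwb⟩ := hA w h0
    exact hout a ha w hw b hb hwb
  let g : ℂ → ℂ := fun w => κ * f w / p.eval w
  have hfc : ∀ a ∈ S, ContinuousOn f (sphere a ρ) := fun a ha =>
    hf.continuousOn.mono (sphere_subset_closedBall.trans (hS a ha))
  have hg : ∀ a ∈ S, ContinuousOn g (sphere a ρ) := fun a ha =>
    (continuousOn_const.mul (hfc a ha)).div p.continuous.continuousOn (hp0 a ha)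
  obtain ⟨r, hr⟩ := exists_polynomial_circleIntegral_divByMonic S hρ.le p hg
  have hherm : IsHermiteInterpolant f A r := by
    intro x hx
    obtain ⟨b, hb, hxb⟩ := hA x hx
    have hfx : AnalyticAt ℂ f x := (hf.mono (ball_subset_closedBall.trans (hS b hb))).analyticAt
      (isOpen_ball.mem_nhds hxb)
    rw [interpolates_iff_le_analyticOrderAt hfx]
    -- Hermite's remainder formula `f - r = p * h`, with `h` holomorphic inside the circles.
    let h : ℂ → ℂ := fun y => ∑ a ∈ S, ∮ w in C(a, ρ), g w / (w - y)
    have hne : ∀ a ∈ S, ∀ w ∈ sphere a ρ, ∀ y ∈ ball b ρ, w - y ≠ 0 := by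
      intro a ha w hw y hy h0
      rw [sub_eq_zero] at h0
      exact hout a ha w hw b hb (h0 ▸ hy)
    have hhd : DifferentiableOn ℂ h (ball b ρ) := by
      refine DifferentiableOn.fun_sum fun a ha => ?_
      refine differentiableOn_circleIntegral_param isOpen_ball hρ.le ?_ ?_
      · refine ContinuousOn.div ?_ (by fun_prop) fun q hq => hne a ha _ hq.2 _ hq.1
        exact (hg a ha).comp continuousOn_snd fun q hq => hq.2
      · intro w hw
        exact (differentiableOn_const _).div (by fun_prop) fun y hy => hne a ha w hw y hy
    have heq : ∀ y ∈ ball b ρ, f y - r.eval y = p.eval y * h y := by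
      intro y hy
      have h1 : f y = ∑ a ∈ S, ∮ w in C(a, ρ), κ * ((w - y)⁻¹ • f w) := by
        rw [Finset.sum_eq_single b]
        · rw [circleIntegral.integral_const_mul,
            (hf.mono (hS b hb)).circleIntegral_sub_inv_smul hy, smul_eq_mul, ← mul_assoc, hκ0,
            one_mul]
        · intro a ha hab
          refine DiffContOnCl.circleIntegral_eq_zero hρ.le (DifferentiableOn.diffContOnCl ?_)
          rw [closure_ball _ hρ.ne']
          have hwd : DifferentiableOn ℂ (fun w => w - y) (closedBall a ρ) := by fun_prop
          refine DifferentiableOn.const_mul ((hwd.fun_inv fun w hw => ?_).fun_smul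
            (hf.mono (hS a ha))) _
          rw [sub_ne_zero]
          rintro rfl
          exact disjoint_left.1 (hdisj ha hb hab) hw (ball_subset_closedBall hy)
        · exact fun h => absurd hb h
      have h2 := hr (Polynomial.leval y)
      rw [Polynomial.leval_apply] at h2
      rw [h1, h2, ← Finset.sum_sub_distrib, Finset.mul_sum]
      refine Finset.sum_congr rfl fun a ha => ?_
      rw [← circleIntegral.integral_sub, ← circleIntegral.integral_const_mul]
      · refine circleIntegral.integral_congr hρ.le fun w hw => ?_
        have hwy := hne a ha w hw y hy
        have hpw := hp0 a ha w hw
        simp only [Polynomial.leval_apply]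
        rw [eval_divByMonic_X_sub_C p (sub_ne_zero.1 hwy).symm]
        have hyw : y - w ≠ 0 := sub_ne_zero.2 (sub_ne_zero.1 hwy).symm
        simp only [g, smul_eq_mul]
        rw [← neg_sub w y]
        field_simp
        ring
      · refine (continuousOn_const.mul (ContinuousOn.smul (ContinuousOn.inv₀ (by fun_prop)
          fun w hw => hne a ha w hw y hy) (hfc a ha))).circleIntegrable hρ.le
      · refine ContinuousOn.circleIntegrable hρ.le ((hg a ha).mul ?_)
        refine ContinuousOn.congr (f := fun w => (p.eval y - p.eval w) / (y - w)) ?_ ?_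
        · refine ContinuousOn.div (by fun_prop) (by fun_prop) fun w hw => ?_
          exact sub_ne_zero.2 (sub_ne_zero.1 (hne a ha w hw y hy)).symm
        · intro w hw
          exact eval_divByMonic_X_sub_C p (sub_ne_zero.1 (hne a ha w hw y hy)).symm
    rw [analyticOrderAt_congr (g := fun y => p.eval y * h y)
      (Filter.eventually_of_mem (isOpen_ball.mem_nhds hxb) heq)]
    exact le_analyticOrderAt_eval_mul (minpolyMult_le_rootMultiplicity_charpoly A x)
      (hhd.analyticAt (isOpen_ball.mem_nhds hxb))
  rw [holoFC_eq_aeval hherm]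
  let l : Polynomial ℂ →ₗ[ℂ] ℂ :=
    (Matrix.entryLinearMap ℂ ℂ i j).comp (Polynomial.aeval A).toLinearMap
  refine (hr l).trans (Finset.sum_congr rfl fun a ha => ?_)
  refine circleIntegral.integral_congr hρ.le fun w hw => ?_
  have hpw := hp0 a ha w hw
  simp only [g, hpe] at hpw ⊢
  congr 1
  exact congrFun (congrFun (aeval_charpoly_divByMonic_X_sub_C A hpw) i) j

theorem mem_specFinset {n : ℕ} {A : Matrix (Fin n) (Fin n) ℂ} {a : ℂ} :
    a ∈ specFinset A ↔ a ∈ spectrum ℂ A := by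
  simp [specFinset]

/-- The spectrum is upper semicontinuous. If `p` is the characteristic polynomial of `F z₀`, then
`p (F z)` is small for `z` near `z₀`, and it has the eigenvalue `∏ (x - a)` for every eigenvalue
`x` of `F z`. -/
theorem eventually_spectrum_subset {n : ℕ} (hn : n ≠ 0) {U : Set ℂ}
    {F : ℂ → Matrix (Fin n) (Fin n) ℂ} (hF : ContinuousOn F U) {z₀ : ℂ} (hU : U ∈ nhds z₀)
    {ρ : ℝ} (hρ : 0 < ρ) :
    ∀ᶠ z in nhds z₀, ∀ x ∈ spectrum ℂ (F z), ∃ a ∈ specFinset (F z₀), x ∈ ball a ρ := by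
  let p := (F z₀).charpoly
  have hM : ContinuousAt (fun z => Polynomial.aeval (F z) p) z₀ :=
    (Polynomial.continuous_aeval p).continuousAt.comp (hF.continuousAt hU)
  have hsum : ContinuousAt (fun z => ∑ i, ∑ j, ‖Polynomial.aeval (F z) p i j‖) z₀ := by
    refine tendsto_finsetSum _ fun i _ => tendsto_finsetSum _ fun j _ => ?_
    exact ((continuousAt_pi.1 (continuousAt_pi.1 hM i)) j).norm
  have h0 : ∑ i, ∑ j, ‖Polynomial.aeval (F z₀) p i j‖ < ρ ^ n := by
    simp only [p, Matrix.aeval_self_charpoly]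
    simpa using pow_pos hρ n
  filter_upwards [hsum.eventually_lt_const h0] with z hz x hx
  have h1 : p.eval x ∈ spectrum ℂ (Polynomial.aeval (F z) p) := by
    rw [spectrum.map_polynomial_aeval_of_nonempty _ _ (spectrum_nonempty hn _)]
    exact mem_image_of_mem _ hx
  have h2 : ‖p.eval x‖ < ρ ^ n := (norm_le_sum_of_mem_spectrum h1).trans_lt hz
  by_contra! hcon
  have hsp : p.Splits := IsAlgClosed.splits _
  have h3 : ρ ^ n ≤ ‖p.eval x‖ := by
    have hmul : ∀ s : Multiset ℂ, (∀ a ∈ s, ρ ≤ ‖x - a‖) →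
        ρ ^ s.card ≤ ‖(s.map fun a => x - a).prod‖ := by
      intro s
      induction s using Multiset.induction with
      | empty => simp
      | cons a s ih =>
        intro h
        rw [Multiset.map_cons, Multiset.prod_cons, norm_mul, Multiset.card_cons, pow_succ']
        exact mul_le_mul (h a (by simp)) (ih fun b hb => h b (by simp [hb])) (by positivity)
          (norm_nonneg _)
    have hcard : p.roots.card = n := by
      rw [← hsp.natDegree_eq_card_roots, Matrix.charpoly_natDegree_eq_dim, Fintype.card_fin]
    rw [hsp.eval_eq_prod_roots_of_monic (F z₀).charpoly_monic, ← hcard]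
    refine hmul _ fun a ha => ?_
    have ha' : a ∈ specFinset (F z₀) := by
      rw [mem_specFinset, mem_spectrum_iff_det, ← Matrix.eval_charpoly]
      exact Polynomial.isRoot_of_mem_roots ha
    simpa [dist_eq_norm] using hcon a ha'
  linarith

/-- The holomorphic functional calculus of a holomorphic family of matrices is holomorphic. -/
theorem differentiableOn_holoFC {n : ℕ} (hn : n ≠ 0) {Ω : Set ℂ} (hΩ : IsOpen Ω) {f : ℂ → ℂ}
    (hf : DifferentiableOn ℂ f Ω) {U : Set ℂ} (hU : IsOpen U)
    {F : ℂ → Matrix (Fin n) (Fin n) ℂ} (hF : ∀ i j, DifferentiableOn ℂ (fun z => F z i j) U)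
    (hFΩ : ∀ z ∈ U, spectrum ℂ (F z) ⊆ Ω) (i j : Fin n) :
    DifferentiableOn ℂ (fun z => holoFC f (F z) i j) U := by
  intro z₀ hz₀
  have hFc : ContinuousOn F U := continuousOn_of_entries fun i j => (hF i j).continuousOn
  let S := specFinset (F z₀)
  obtain ⟨ρ, hρ, hS, hdisj⟩ : ∃ ρ : ℝ, 0 < ρ ∧ (∀ a ∈ S, closedBall a ρ ⊆ Ω) ∧
      (S : Set ℂ).PairwiseDisjoint fun a => closedBall a ρ := by
    have h1 : ∀ᶠ ρ in nhds (0 : ℝ), ∀ a ∈ S, closedBall a ρ ⊆ Ω := by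
      refine (Filter.eventually_all_finset S).2 fun a ha => ?_
      exact eventually_closedBall_subset (hΩ.mem_nhds (hFΩ z₀ hz₀ (mem_specFinset.1 ha)))
    have h2 : ∀ᶠ ρ in nhds (0 : ℝ), ∀ a ∈ S, ∀ b ∈ S, a ≠ b →
        Disjoint (closedBall a ρ) (closedBall b ρ) := by
      refine (Filter.eventually_all_finset S).2 fun a _ => (Filter.eventually_all_finset S).2
        fun b _ => Filter.eventually_all.2 fun hab => ?_
      filter_upwards [eventually_lt_nhds (half_pos (dist_pos.2 hab))] with ρ hρ
      exact closedBall_disjoint_closedBall (by linarith)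
    obtain ⟨ρ, ⟨h1, h2⟩, hρ⟩ := (((h1.and h2).filter_mono nhdsWithin_le_nhds).and
      (self_mem_nhdsWithin (s := Ioi (0 : ℝ)))).exists
    exact ⟨ρ, hρ, h1, fun a ha b hb hab => h2 a ha b hb hab⟩
  obtain ⟨V, hVsub, hVo, hzV⟩ := _root_.mem_nhds_iff.1 (Filter.inter_mem (hU.mem_nhds hz₀)
    (eventually_spectrum_subset hn hFc (hU.mem_nhds hz₀) hρ))
  have hVU : V ⊆ U := fun z hz => (hVsub hz).1
  have hdet : ∀ a ∈ S, ∀ z ∈ V, ∀ w ∈ sphere a ρ, (Matrix.scalar (Fin n) w - F z).det ≠ 0 := by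
    intro a ha z hz w hw h0
    obtain ⟨b, hb, hwb⟩ := (hVsub hz).2 w ((mem_spectrum_iff_det _ _).2 h0)
    by_cases hab : a = b
    · subst hab; exact (mem_ball.1 hwb).ne (mem_sphere.1 hw)
    · exact disjoint_left.1 (hdisj ha hb hab) (sphere_subset_closedBall hw)
        (ball_subset_closedBall hwb)
  have key : DifferentiableOn ℂ (fun z => ∑ a ∈ S, ∮ w in C(a, ρ),
      ((2 * Real.pi * Complex.I)⁻¹ * f w / (Matrix.scalar (Fin n) w - F z).det)
        * (Matrix.scalar (Fin n) w - F z).adjugate i j) V := by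
    refine DifferentiableOn.fun_sum fun a ha => ?_
    have hmat : ContinuousOn (fun q : ℂ × ℂ => Matrix.scalar (Fin n) q.2 - F q.1)
        (V ×ˢ sphere a ρ) := by
      refine continuousOn_of_entries fun k l => ?_
      have h1 : ContinuousOn (fun q : ℂ × ℂ => F q.1 k l) (V ×ˢ sphere a ρ) :=
        ((hF k l).continuousOn.mono hVU).comp continuousOn_fst fun q hq => hq.1
      by_cases hkl : k = l
      · subst hkl; simpa using continuousOn_snd.fun_sub h1
      · simpa [hkl] using h1.fun_neg
    have hmatd : ∀ w : ℂ, ∀ k l, DifferentiableOn ℂ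
        (fun z => (Matrix.scalar (Fin n) w - F z) k l) V := fun w k l =>
      ((hF k l).mono hVU).const_sub ((Matrix.scalar (Fin n) w) k l)
    refine differentiableOn_circleIntegral_param hVo hρ.le ?_ ?_
    · refine ContinuousOn.mul (ContinuousOn.div (continuousOn_const.mul ?_) hmat.det
        fun q hq => hdet a ha _ hq.1 _ hq.2) (hmat.adjugate.entry i j)
      exact (hf.continuousOn.mono (sphere_subset_closedBall.trans (hS a ha))).comp continuousOn_snd
        fun q hq => hq.2
    · intro w hw
      exact ((differentiableOn_const _).div (differentiableOn_det (hmatd w))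
        fun z hz => hdet a ha z hz w hw).mul (differentiableOn_adjugate (hmatd w) i j)
  refine DifferentiableAt.differentiableWithinAt ?_
  refine (key.differentiableAt (hVo.mem_nhds hzV)).congr_of_eventuallyEq ?_
  filter_upwards [hVo.mem_nhds hzV] with z hz
  exact holoFC_apply_eq_sum_circleIntegral hf hρ hS hdisj (hVsub hz).2 i j

/-! ### Zeros of families of holomorphic functions -/

/-- The maximum principle for the reciprocal of a holomorphic function without zeros. -/
theorem le_norm_of_le_norm_sphere {g : ℂ → ℂ} {c : ℂ} {r δ : ℝ} (hr : 0 < r)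
    (hg : DifferentiableOn ℂ g (closedBall c r)) (hne : ∀ z ∈ closedBall c r, g z ≠ 0) (hδ : 0 < δ)
    (hs : ∀ z ∈ sphere c r, δ ≤ ‖g z‖) {z : ℂ} (hz : z ∈ closedBall c r) : δ ≤ ‖g z‖ := by
  have hd : DiffContOnCl ℂ (fun z => (g z)⁻¹) (ball c r) := by
    refine DifferentiableOn.diffContOnCl ?_
    rw [closure_ball _ hr.ne']
    exact hg.fun_inv hne
  have h := Complex.norm_le_of_forall_mem_frontier_norm_le (C := δ⁻¹) isBounded_ball hd
    (fun w hw => by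
      rw [frontier_ball _ hr.ne'] at hw
      rw [norm_inv]
      exact inv_anti₀ hδ (hs w hw)) (z := z) (by rwa [closure_ball _ hr.ne'])
  rw [norm_inv] at h
  exact (inv_le_inv₀ (norm_pos_iff.2 (hne z hz)) hδ).1 h

theorem exists_pos_forall_dist_lt {K : Set ℂ} (hK : IsCompact K) {u : ℝ → ℂ → ℂ}
    (hc : ContinuousOn (Function.uncurry u) (Icc 0 1 ×ˢ K)) {ε : ℝ} (hε : 0 < ε) :
    ∃ η > 0, ∀ s ∈ Icc (0 : ℝ) 1, ∀ t ∈ Icc (0 : ℝ) 1, |s - t| < η → ∀ z ∈ K,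
      ‖u s z - u t z‖ < ε := by
  have hu := (isCompact_Icc.prod hK).uniformContinuousOn_of_continuous hc
  obtain ⟨η, hη, h⟩ := Metric.uniformContinuousOn_iff.1 hu ε hε
  refine ⟨η, hη, fun s hs t ht hst z hz => ?_⟩
  have := h (s, z) ⟨hs, hz⟩ (t, z) ⟨ht, hz⟩ (by simpa [Prod.dist_eq, Real.dist_eq, hη] using hst)
  simpa [dist_eq_norm] using this

/-- If no member of a continuous family of holomorphic functions on a closed disc has a zero on the
boundary circle and the first member has no zero at all, then the last member has no zero. -/
theorem ne_zero_of_homotopy {u : ℝ → ℂ → ℂ} {c : ℂ} {r : ℝ} (hr : 0 < r)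
    (hc : ContinuousOn (Function.uncurry u) (Icc 0 1 ×ˢ closedBall c r))
    (hd : ∀ s ∈ Icc (0 : ℝ) 1, DifferentiableOn ℂ (u s) (closedBall c r))
    (hs : ∀ s ∈ Icc (0 : ℝ) 1, ∀ z ∈ sphere c r, u s z ≠ 0)
    (h0 : ∀ z ∈ closedBall c r, u 0 z ≠ 0) {z : ℂ} (hz : z ∈ closedBall c r) : u 1 z ≠ 0 := by
  obtain ⟨⟨s₀, z₀⟩, ⟨hs₀, hz₀⟩, hmin⟩ := (isCompact_Icc.prod (isCompact_sphere c r)).exists_isMinOn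
    (s := Icc (0 : ℝ) 1 ×ˢ sphere c r)
    ((nonempty_Icc.2 zero_le_one).prod (NormedSpace.sphere_nonempty.2 hr.le))
    (hc.mono (prod_mono subset_rfl sphere_subset_closedBall)).norm
  set δ : ℝ := ‖u s₀ z₀‖ with hδ
  have hδ0 : 0 < δ := norm_pos_iff.2 (hs s₀ hs₀ z₀ hz₀)
  have hsph : ∀ s ∈ Icc (0 : ℝ) 1, ∀ z ∈ sphere c r, δ ≤ ‖u s z‖ := fun s h z hz =>
    hmin (show (s, z) ∈ Icc (0 : ℝ) 1 ×ˢ sphere c r from ⟨h, hz⟩)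
  obtain ⟨η, hη, hunif⟩ := exists_pos_forall_dist_lt (isCompact_closedBall c r) hc hδ0
  obtain ⟨N, hN⟩ := exists_nat_gt (1 / η)
  have hNpos : (0 : ℝ) < N := lt_trans (by positivity) hN
  have hmem : ∀ k : ℕ, k ≤ N → (k : ℝ) / N ∈ Icc (0 : ℝ) 1 := fun k hk =>
    ⟨by positivity, (div_le_one hNpos).2 (by exact_mod_cast hk)⟩
  -- A member within `δ` of one bounded below by `δ` has no zero, hence is itself bounded below by `δ`.
  have hstep : ∀ k : ℕ, k ≤ N → ∀ z ∈ closedBall c r, δ ≤ ‖u (k / N) z‖ := by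
    intro k
    induction k with
    | zero =>
      intro hk z hz
      refine le_norm_of_le_norm_sphere hr (hd _ (hmem 0 hk)) ?_ hδ0 (hsph _ (hmem 0 hk)) hz
      simpa using h0
    | succ k ih =>
      intro hk z hz
      refine le_norm_of_le_norm_sphere hr (hd _ (hmem _ hk)) ?_ hδ0 (hsph _ (hmem _ hk)) hz
      intro x hx hx0
      have h1 := ih (by omega) x hx
      have h2 := hunif _ (hmem k (by omega)) _ (hmem _ hk) ?_ x hx
      · rw [hx0, sub_zero] at h2; linarith
      · rw [abs_sub_comm, ← sub_div, Nat.cast_succ, add_sub_cancel_left, abs_of_pos (by positivity)]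
        exact (div_lt_comm₀ hη hNpos).1 hN
  have := hstep N le_rfl z hz
  rw [div_self hNpos.ne'] at this
  exact norm_pos_iff.1 (hδ0.trans_le this)

/-- Hurwitz's theorem: a limit of zero-free holomorphic functions on a domain that has a zero
vanishes identically. -/
theorem eqOn_zero_of_hurwitz {u : ℝ → ℂ → ℂ} {U : Set ℂ} (hU : IsOpen U) (hUc : IsPreconnected U)
    (hc : ContinuousOn (Function.uncurry u) (Icc 0 1 ×ˢ U))
    (hd : ∀ s ∈ Icc (0 : ℝ) 1, DifferentiableOn ℂ (u s) U)
    (hne : ∀ s ∈ Ioc (0 : ℝ) 1, ∀ z ∈ U, u s z ≠ 0) {z₁ : ℂ} (hz₁ : z₁ ∈ U) (h0 : u 0 z₁ = 0) :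
    EqOn (u 0) 0 U := by
  have hd0 := hd 0 (by simp)
  have han : AnalyticOnNhd ℂ (u 0) U := hd0.analyticOnNhd hU
  rcases (han z₁ hz₁).eventually_eq_zero_or_eventually_ne_zero with h | h
  · exact han.eqOn_zero_of_preconnected_of_eventuallyEq_zero hUc hz₁ h
  exfalso
  obtain ⟨r, hr, hsub⟩ := Metric.nhds_basis_closedBall.mem_iff.1
    (Filter.inter_mem (hU.mem_nhds hz₁) (eventually_nhdsWithin_iff.1 h))
  have hrU : closedBall z₁ r ⊆ U := fun x hx => (hsub hx).1
  obtain ⟨z₀, hz₀, hmin⟩ := (isCompact_sphere z₁ r).exists_isMinOn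
    (NormedSpace.sphere_nonempty.2 hr.le)
    (hd0.continuousOn.mono (sphere_subset_closedBall.trans hrU)).norm
  have hδ : 0 < ‖u 0 z₀‖ := by
    refine norm_pos_iff.2 ((hsub (sphere_subset_closedBall hz₀)).2 ?_)
    rintro rfl
    simp only [mem_sphere, dist_self] at hz₀
    exact hr.ne hz₀
  obtain ⟨η, hη, hunif⟩ := exists_pos_forall_dist_lt (isCompact_closedBall z₁ r)
    (hc.mono (prod_mono subset_rfl hrU)) (half_pos hδ)
  have hs0 : 0 < min (η / 2) 1 := by positivity
  have hs : min (η / 2) 1 ∈ Ioc (0 : ℝ) 1 := ⟨hs0, min_le_right _ _⟩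
  have hclose : ∀ x ∈ closedBall z₁ r, ‖u (min (η / 2) 1) x - u 0 x‖ < ‖u 0 z₀‖ / 2 := by
    refine hunif _ (Ioc_subset_Icc_self hs) 0 (by simp) ?_
    rw [sub_zero, abs_of_pos hs0]
    exact (min_le_left _ _).trans_lt (by linarith)
  have h1 := le_norm_of_le_norm_sphere hr ((hd _ (Ioc_subset_Icc_self hs)).mono hrU)
    (fun x hx => hne _ hs x (hrU hx)) (half_pos hδ) (fun x hx => by
      have a1 : ‖u 0 z₀‖ ≤ ‖u 0 x‖ := hmin hx
      have a2 := hclose x (sphere_subset_closedBall hx)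
      have a3 := norm_sub_norm_le (u 0 x) (u (min (η / 2) 1) x)
      rw [norm_sub_rev] at a3
      linarith) (mem_closedBall_self hr.le)
  have h2 := hclose z₁ (mem_closedBall_self hr.le)
  rw [h0, sub_zero] at h2
  linarith

/-- A holomorphic function on a domain with uncountably many zeros vanishes identically. -/
theorem eqOn_zero_of_not_countable {h : ℂ → ℂ} {U : Set ℂ} (hU : IsOpen U) (hUc : IsPreconnected U)
    (hd : DifferentiableOn ℂ h U) (hz : ¬ {x ∈ U | h x = 0}.Countable) : EqOn h 0 U := by
  have han : AnalyticOnNhd ℂ h U := hd.analyticOnNhd hU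
  by_contra hne
  have hiso : ∀ x ∈ U, ∃ V ∈ nhds x, ∀ y ∈ V, h y = 0 → y = x := by
    intro x hx
    rcases (han x hx).eventually_eq_zero_or_eventually_ne_zero with h' | h'
    · exact absurd (han.eqOn_zero_of_preconnected_of_eventuallyEq_zero hUc hx h') hne
    · exact ⟨_, eventually_nhdsWithin_iff.1 h', fun y hy hy0 => by
        by_contra hyx
        exact hy hyx hy0⟩
  choose! V hV hVz using hiso
  obtain ⟨t, htU, htc, hcov⟩ := TopologicalSpace.countable_cover_nhdsWithin
    fun x hx => mem_nhdsWithin_of_mem_nhds (s := V x) (t := U) (hV x hx)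
  refine hz (htc.mono fun x hx => ?_)
  obtain ⟨y, hy, hxy⟩ := mem_iUnion₂.1 (hcov hx.1)
  rw [hVz y (htU hy) x hxy hx.2]
  exact hy

/-! ### Automorphisms of the disc -/

theorem norm_discAut_lt_one {a z : ℂ} (ha : ‖a‖ < 1) (hz : ‖z‖ < 1) : ‖discAut a z‖ < 1 :=
  moebiusDist_lt_one hz ha

theorem discAut_neg_discAut {a z : ℂ} (ha : ‖a‖ < 1) (hz : ‖z‖ < 1) :
    discAut (-a) (discAut a z) = z := by
  have h1 := one_sub_conj_mul_ne_zero hz ha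
  have h3 : 1 - (starRingEnd ℂ) (-a) * ((z - a) / (1 - (starRingEnd ℂ) a * z)) ≠ 0 := by
    refine one_sub_conj_mul_ne_zero (norm_discAut_lt_one ha hz) (by rwa [norm_neg])
  unfold discAut
  rw [div_eq_iff h3, map_neg]
  rw [mul_comm ((starRingEnd ℂ) a)] at h1
  field_simp
  ring

theorem differentiableOn_discAut {a : ℂ} (ha : ‖a‖ < 1) :
    DifferentiableOn ℂ (discAut a) (ball 0 1) := by
  unfold discAut
  refine DifferentiableOn.div (by fun_prop) (by fun_prop) fun z hz => ?_
  exact one_sub_conj_mul_ne_zero (mem_ball_zero_iff.1 hz) ha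

theorem discAut_ne_zero {a z : ℂ} (ha : ‖a‖ < 1) (hz : ‖z‖ < 1) (h : z ≠ a) : discAut a z ≠ 0 :=
  div_ne_zero (sub_ne_zero.2 h) (one_sub_conj_mul_ne_zero hz ha)

/-- Near the boundary of the disc a disc automorphism is close to `1` in modulus. -/
theorem exists_radius_lt_norm_discAut {a : ℂ} (ha : ‖a‖ < 1) {M r₀ : ℝ} (hM0 : 0 ≤ M) (hM : M < 1)
    (hr₀ : r₀ < 1) : ∃ r, r₀ < r ∧ 0 < r ∧ r < 1 ∧ ∀ z ∈ sphere (0 : ℂ) r, M < ‖discAut a z‖ := by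
  have hsub : closedBall (0 : ℂ) M ⊆ ball 0 1 := closedBall_subset_ball hM
  obtain ⟨y, hy, hmax⟩ := (isCompact_closedBall (0 : ℂ) M).exists_isMaxOn
    ⟨0, mem_closedBall_self hM0⟩
    ((differentiableOn_discAut (a := -a) (by rwa [norm_neg])).continuousOn.mono hsub).norm
  have h1 : ‖discAut (-a) y‖ < 1 :=
    norm_discAut_lt_one (by rwa [norm_neg]) (mem_ball_zero_iff.1 (hsub hy))
  obtain ⟨r, hr, hr1⟩ := exists_between (max_lt h1 hr₀)
  have hr' : ‖discAut (-a) y‖ < r := (le_max_left _ _).trans_lt hr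
  refine ⟨r, (le_max_right _ _).trans_lt hr, (norm_nonneg _).trans_lt hr', hr1, fun z hz => ?_⟩
  by_contra! hcon
  have hz' : ‖z‖ = r := mem_sphere_zero_iff_norm.1 hz
  have h2 : ‖discAut (-a) (discAut a z)‖ ≤ ‖discAut (-a) y‖ :=
    hmax (mem_closedBall_zero_iff.2 hcon)
  rw [discAut_neg_discAut ha (hz'.trans_lt hr1), hz'] at h2
  linarith

/-! ### The Schwarz lemma for the spectral unit ball -/

/-- Removing a zero of a matrix-valued holomorphic function on the disc. -/
theorem exists_eq_discAut_smul {n : ℕ} {A : ℂ → Matrix (Fin n) (Fin n) ℂ}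
    (hA : ∀ i j, DifferentiableOn ℂ (fun z => A z i j) (ball 0 1)) {a : ℂ} (ha : ‖a‖ < 1)
    (hA0 : A a = 0) : ∃ E : ℂ → Matrix (Fin n) (Fin n) ℂ,
      (∀ i j, DifferentiableOn ℂ (fun z => E z i j) (ball 0 1)) ∧
      ∀ z ∈ ball (0 : ℂ) 1, A z = discAut a z • E z := by
  refine ⟨fun z => Matrix.of fun i j =>
    dslope (fun z => A z i j) a z * (1 - (starRingEnd ℂ) a * z), fun i j => ?_, fun z hz => ?_⟩
  · have hnhds : ball (0 : ℂ) 1 ∈ nhds a := isOpen_ball.mem_nhds (mem_ball_zero_iff.2 ha)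
    simp only [Matrix.of_apply]
    exact ((Complex.differentiableOn_dslope hnhds).2 (hA i j)).mul (by fun_prop)
  · ext i j
    have h1 := one_sub_conj_mul_ne_zero (mem_ball_zero_iff.1 hz) ha
    have h2 := sub_smul_dslope (fun z => A z i j) a z
    simp only [hA0, Matrix.zero_apply, sub_zero, smul_eq_mul] at h2
    simp only [Matrix.smul_apply, Matrix.of_apply, smul_eq_mul, discAut]
    rw [← h2]
    rw [mul_comm ((starRingEnd ℂ) a)] at h1 ⊢
    field_simp

/-- The Schwarz lemma for the spectral unit ball. On a circle close to the boundary the eigenvalues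
of `E` are barely larger than `1` in modulus, so `det (1 - s t E)`, for `|t| < 1` and
`0 ≤ s ≤ 1`, has no zero there. -/
theorem norm_le_one_of_mem_spectrum {n : ℕ} {A E : ℂ → Matrix (Fin n) (Fin n) ℂ}
    (hE : ∀ i j, DifferentiableOn ℂ (fun z => E z i j) (ball 0 1))
    (hA : ∀ z ∈ ball (0 : ℂ) 1, spectrum ℂ (A z) ⊆ ball 0 1) {a : ℂ} (ha : ‖a‖ < 1)
    (hAE : ∀ z ∈ ball (0 : ℂ) 1, A z = discAut a z • E z) {z : ℂ} (hz : z ∈ ball (0 : ℂ) 1)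
    {c : ℂ} (hc : c ∈ spectrum ℂ (E z)) : ‖c‖ ≤ 1 := by
  by_contra! h
  have hc0 : c ≠ 0 := by rintro rfl; simp at h; linarith
  obtain ⟨r, hzr, hr0, hr1, hr⟩ := exists_radius_lt_norm_discAut ha (M := ‖c‖⁻¹) (by positivity)
    (inv_lt_one_of_one_lt₀ h) (mem_ball_zero_iff.1 hz)
  have hsub : closedBall (0 : ℂ) r ⊆ ball 0 1 := closedBall_subset_ball hr1
  have key := ne_zero_of_homotopy (u := fun s w => (1 - ((s : ℂ) * c⁻¹) • E w).det) (c := 0) hr0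
    ?_ ?_ ?_ ?_ (z := z) (mem_closedBall_zero_iff.2 hzr.le)
  · refine key ?_
    simpa using det_one_sub_eq_zero hc0 hc
  · refine ContinuousOn.det (continuousOn_of_entries fun i j => ?_)
    have h1 : ContinuousOn (fun q : ℝ × ℂ => E q.2 i j) (Icc 0 1 ×ˢ closedBall (0 : ℂ) r) :=
      ((hE i j).continuousOn.mono hsub).comp continuousOn_snd fun q hq => hq.2
    have h2 : Continuous fun q : ℝ × ℂ => (q.1 : ℂ) * c⁻¹ := by fun_prop
    exact continuousOn_const.fun_sub (h2.continuousOn.fun_mul h1)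
  · intro s _
    refine differentiableOn_det fun i j => ?_
    exact (((hE i j).mono hsub).const_mul ((s : ℂ) * c⁻¹)).const_sub
      ((1 : Matrix (Fin n) (Fin n) ℂ) i j)
  · intro s hs w hw h0
    have hw1 : w ∈ ball (0 : ℂ) 1 := hsub (sphere_subset_closedBall hw)
    rcases eq_or_ne s 0 with rfl | hs0
    · simp at h0
    have hsc : (s : ℂ) * c⁻¹ ≠ 0 := mul_ne_zero (by exact_mod_cast hs0) (inv_ne_zero hc0)
    have h1 := smul_mem_spectrum_smul (discAut a w) (mem_spectrum_of_det_one_sub hsc h0)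
    rw [← hAE w hw1] at h1
    have h2 := mem_ball_zero_iff.1 (hA w hw1 h1)
    rw [norm_mul, norm_inv, norm_mul, norm_inv, Complex.norm_real, Real.norm_of_nonneg hs.1] at h2
    have hspos : 0 < s := lt_of_le_of_ne hs.1 hs0.symm
    have hcpos : 0 < ‖c‖ := norm_pos_iff.2 hc0
    have h3 := hr w hw
    rw [← div_eq_mul_inv, div_lt_one (by positivity)] at h2
    have h4 : s * ‖c‖⁻¹ ≤ 1 * ‖c‖⁻¹ := mul_le_mul_of_nonneg_right hs.2 (by positivity)
    linarith
  · intro w _; simp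

/-- If the spectra of a holomorphic family of matrices lie in the closed disc, then a unimodular
eigenvalue of one member is an eigenvalue of all. -/
theorem mem_spectrum_of_norm_eq_one {n : ℕ} {E : ℂ → Matrix (Fin n) (Fin n) ℂ} {U : Set ℂ}
    (hU : IsOpen U) (hUc : IsPreconnected U)
    (hE : ∀ i j, DifferentiableOn ℂ (fun z => E z i j) U)
    (hle : ∀ z ∈ U, ∀ c ∈ spectrum ℂ (E z), ‖c‖ ≤ 1) {z₁ : ℂ} (hz₁ : z₁ ∈ U) {c : ℂ}
    (hc : c ∈ spectrum ℂ (E z₁)) (hc1 : ‖c‖ = 1) {z : ℂ} (hz : z ∈ U) :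
    c ∈ spectrum ℂ (E z) := by
  have key := eqOn_zero_of_hurwitz hU hUc
    (u := fun s w => (Matrix.scalar (Fin n) ((1 + (s : ℂ)) * c) - E w).det) ?_ ?_ ?_ hz₁ ?_ hz
  · rw [mem_spectrum_iff_det]
    simpa using key
  · refine ContinuousOn.det (continuousOn_of_entries fun i j => ?_)
    have h1 : ContinuousOn (fun q : ℝ × ℂ => E q.2 i j) (Icc 0 1 ×ˢ U) :=
      (hE i j).continuousOn.comp continuousOn_snd fun q hq => hq.2
    have h2 : Continuous fun q : ℝ × ℂ => (Matrix.scalar (Fin n) ((1 + (q.1 : ℂ)) * c)) i j := by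
      by_cases hij : i = j
      · subst hij; simp; fun_prop
      · simp [hij]; fun_prop
    exact h2.continuousOn.fun_sub h1
  · intro s _
    refine differentiableOn_det fun i j => ?_
    exact (hE i j).const_sub ((Matrix.scalar (Fin n) ((1 + (s : ℂ)) * c)) i j)
  · intro s hs w hw h0
    have h1 := hle w hw _ ((mem_spectrum_iff_det _ _).2 h0)
    have h2 : ‖(1 + (s : ℂ))‖ = 1 + s := by
      rw [← Complex.ofReal_one, ← Complex.ofReal_add, Complex.norm_real,
        Real.norm_of_nonneg (by linarith [hs.1])]
    rw [norm_mul, hc1, h2] at h1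
    linarith [hs.1]
  · simpa using (mem_spectrum_iff_det _ _).1 hc

/-! ### Products of holomorphic maps into the disc -/

theorem norm_prod_pow_lt_one {ι : Type*} {T : Finset ι} {g : ι → ℂ} {m : ι → ℕ}
    (h : ∀ i ∈ T, ‖g i‖ < 1) (hm : ∃ i ∈ T, 0 < m i) : ‖∏ i ∈ T, g i ^ m i‖ < 1 := by
  classical
  obtain ⟨i, hi, hmi⟩ := hm
  rw [norm_prod, ← Finset.mul_prod_erase _ _ hi]
  have h1 : ‖g i ^ m i‖ < 1 := by
    rw [norm_pow]; exact pow_lt_one₀ (norm_nonneg _) (h i hi) hmi.ne'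
  have h2 : ∏ j ∈ T.erase i, ‖g j ^ m j‖ ≤ 1 := by
    refine Finset.prod_le_one (fun j _ => norm_nonneg _) fun j hj => ?_
    rw [norm_pow]
    exact pow_le_one₀ (norm_nonneg _) (h j (Finset.mem_of_mem_erase hj)).le
  calc _ ≤ ‖g i ^ m i‖ * 1 := mul_le_mul_of_nonneg_left h2 (norm_nonneg _)
    _ < 1 := by rwa [mul_one]

theorem le_analyticOrderAt_prod_pow {ι : Type*} {T : Finset ι} {g : ι → ℂ → ℂ} {m : ι → ℕ} {x : ℂ}
    (hg : ∀ i ∈ T, AnalyticAt ℂ (g i) x) {i : ι} (hi : i ∈ T) (h0 : g i x = 0) :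
    (m i : ℕ∞) ≤ analyticOrderAt (fun y => ∏ j ∈ T, g j y ^ m j) x := by
  classical
  have h1 : AnalyticAt ℂ (fun y => ∏ j ∈ T.erase i, g j y ^ m j) x :=
    Finset.analyticAt_fun_prod _ fun j hj => (hg j (Finset.mem_of_mem_erase hj)).fun_pow _
  have h2 : (fun y => ∏ j ∈ T, g j y ^ m j)
      = (g i ^ m i) * fun y => ∏ j ∈ T.erase i, g j y ^ m j := by
    ext y; exact (Finset.mul_prod_erase _ _ hi).symm
  have h3 : 1 ≤ analyticOrderAt (g i) x :=
    Order.one_le_iff_ne_zero.2 ((hg i hi).analyticOrderAt_ne_zero.2 h0)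
  rw [h2, analyticOrderAt_mul ((hg i hi).pow _) h1, analyticOrderAt_pow (hg i hi)]
  refine le_add_right ?_
  rw [nsmul_eq_mul]
  exact le_mul_of_one_le_right zero_le h3

theorem differentiableOn_prod_pow {ι : Type*} {T : Finset ι} {g : ι → ℂ → ℂ} {m : ι → ℕ} {U : Set ℂ}
    (hg : ∀ i ∈ T, DifferentiableOn ℂ (g i) U) :
    DifferentiableOn ℂ (fun y => ∏ j ∈ T, g j y ^ m j) U :=
  DifferentiableOn.fun_finsetProd fun i hi => (hg i hi).fun_pow _

theorem isCaratheodoryExtremal_caratheodoryExtremal {Ω : Set ℂ} (hΩ : IsOpen Ω)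
    (hc : IsConnected Ω) {p q : ℂ} (hp : p ∈ Ω) (hq : q ∈ Ω) :
    IsCaratheodoryExtremal Ω p q (caratheodoryExtremal Ω p q) := by
  have h := exists_isCaratheodoryExtremal hΩ hc hp hq
  rw [caratheodoryExtremal, dif_pos h]
  exact h.choose_spec

section genMinBlaschke

variable {n : ℕ} {Ω : Set ℂ} {A : Matrix (Fin n) (Fin n) ℂ} {z : ℂ}

theorem differentiableOn_genMinBlaschke (hΩ : IsOpen Ω) (hc : IsConnected Ω)
    (hA : spectrum ℂ A ⊆ Ω) (hz : z ∈ Ω) : DifferentiableOn ℂ (genMinBlaschke Ω A z) Ω :=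
  differentiableOn_prod_pow fun _ ha =>
    (isCaratheodoryExtremal_caratheodoryExtremal hΩ hc (hA (mem_specFinset.1 ha)) hz).1

theorem mapsTo_genMinBlaschke (hn : n ≠ 0) (hΩ : IsOpen Ω) (hc : IsConnected Ω)
    (hA : spectrum ℂ A ⊆ Ω) (hz : z ∈ Ω) : MapsTo (genMinBlaschke Ω A z) Ω (ball 0 1) := by
  intro x hx
  rw [mem_ball_zero_iff]
  obtain ⟨a, ha⟩ := spectrum_nonempty hn A
  refine norm_prod_pow_lt_one (fun b hb => ?_) ⟨a, mem_specFinset.2 ha, minpolyMult_pos ha⟩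
  exact mem_ball_zero_iff.1
    ((isCaratheodoryExtremal_caratheodoryExtremal hΩ hc (hA (mem_specFinset.1 hb)) hz).2.1 hx)

theorem holoFC_genMinBlaschke_self (hΩ : IsOpen Ω) (hc : IsConnected Ω)
    (hA : spectrum ℂ A ⊆ Ω) (hz : z ∈ Ω) : holoFC (genMinBlaschke Ω A z) A = 0 := by
  have hext : ∀ b ∈ specFinset A, IsCaratheodoryExtremal Ω b z (caratheodoryExtremal Ω b z) :=
    fun b hb => isCaratheodoryExtremal_caratheodoryExtremal hΩ hc (hA (mem_specFinset.1 hb)) hz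
  refine holoFC_eq_zero (fun a ha => ?_) fun a ha => ?_
  · exact (differentiableOn_genMinBlaschke hΩ hc hA hz).analyticAt (hΩ.mem_nhds (hA ha))
  · exact le_analyticOrderAt_prod_pow (m := fun b => minpolyMult A b)
      (fun b hb => (hext b hb).1.analyticAt (hΩ.mem_nhds (hA ha))) (mem_specFinset.2 ha)
      (hext a (mem_specFinset.2 ha)).2.2.1

end genMinBlaschke

/-! ### Multiplicities in the minimal polynomial of `f(A)` -/

theorem X_sub_C_pow_dvd_of_le_analyticOrderAt {P : Polynomial ℂ} {a : ℂ} {t : ℕ}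
    (h : (t : ℕ∞) ≤ analyticOrderAt (fun x => P.eval x) a) :
    (Polynomial.X - Polynomial.C a) ^ t ∣ P := by
  rw [X_sub_C_pow_dvd_iff_taylor]
  intro j hj
  have h1 := (natCast_le_analyticOrderAt_iff_iteratedDeriv_eq_zero
    (analyticAt_eval_polynomial P a)).1 h j hj
  rw [iteratedDeriv_eval_polynomial] at h1
  have h2 := eval_iterate_derivative_eq_taylor P a j
  exact (mul_eq_zero.1 (h2.symm.trans h1)).resolve_left (by exact_mod_cast j.factorial_ne_zero)

theorem minpoly_dvd_of_forall {n : ℕ} {A : Matrix (Fin n) (Fin n) ℂ} {Q : Polynomial ℂ}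
    (h : ∀ a ∈ spectrum ℂ A, (Polynomial.X - Polynomial.C a) ^ minpolyMult A a ∣ Q) :
    minpoly ℂ A ∣ Q := by
  have hmon : (minpoly ℂ A).Monic := minpoly.monic (Matrix.isIntegral A)
  have hsp : (minpoly ℂ A).Splits := IsAlgClosed.splits _
  rw [hsp.eq_prod_roots_of_monic hmon, Finset.prod_multiset_map_count]
  refine Finset.prod_dvd_of_coprime ?_ ?_
  · intro a _ b _ hab
    exact (Polynomial.pairwise_coprime_X_sub_C Function.injective_id hab).pow
  · intro a ha
    rw [Polynomial.count_roots]
    refine h a ?_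
    rw [mem_spectrum_iff_isRoot_minpoly]
    exact Polynomial.isRoot_of_mem_roots (Multiset.mem_toFinset.1 ha)

/-- If `P` interpolates `f` at `A`, then `(P - f a) ^ q` vanishes at `a` to order at least the
multiplicity of `a`: with `o` the order at `a` of `f - f a`, which is `ord f' + 1`, and `m` the
multiplicity, `P - f a` vanishes to order `min o m`, and `q ≥ ⌈m / o⌉`. -/
theorem X_sub_C_pow_dvd_pow_blaschkeExponent {n : ℕ} {f : ℂ → ℂ} {A : Matrix (Fin n) (Fin n) ℂ}
    {P : Polynomial ℂ} (hP : IsHermiteInterpolant f A P) {a : ℂ} (ha : a ∈ spectrum ℂ A)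
    (hf : AnalyticAt ℂ f a) :
    (Polynomial.X - Polynomial.C a) ^ minpolyMult A a ∣
      (P - Polynomial.C (f a)) ^ blaschkeExponent f A (f a) := by
  classical
  set m := minpolyMult A a with hm
  set o := analyticOrderNatAt (deriv f) a + 1 with ho
  set q := blaschkeExponent f A (f a) with hq
  have hqle : (m - 1) / o + 1 ≤ q := by
    rw [hq, blaschkeExponent]
    exact Finset.le_sup (f := fun a => (minpolyMult A a - 1) /
      (analyticOrderNatAt (deriv f) a + 1) + 1)
      (Finset.mem_filter.2 ⟨mem_specFinset.2 ha, rfl⟩)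
  have hdvd : (Polynomial.X - Polynomial.C a) ^ min o m ∣ P - Polynomial.C (f a) := by
    refine X_sub_C_pow_dvd_of_le_analyticOrderAt ?_
    have h1 : (o : ℕ∞) ≤ analyticOrderAt (fun x => f x - f a) a := by
      rw [← hf.analyticOrderAt_deriv_add_one, ho, Nat.cast_add, Nat.cast_one]
      gcongr
      exact ENat.natCast_toNat_le_self _
    have h2 := (interpolates_iff_le_analyticOrderAt hf P m).1 (hP a ha)
    have h3 := (le_min ((Nat.cast_le.2 (min_le_left o m)).trans h1)
      ((Nat.cast_le.2 (min_le_right o m)).trans h2)).trans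
      (le_analyticOrderAt_sub (f := fun x => f x - f a) (g := fun x => f x - P.eval x))
    refine h3.trans (le_of_eq (congrArg (fun g => analyticOrderAt g a) ?_))
    ext x; simp
  refine (pow_dvd_pow _ ?_).trans ((pow_mul (Polynomial.X - Polynomial.C a) (min o m) q) ▸
    pow_dvd_pow_of_dvd hdvd q)
  -- Both cases of `m ≤ min o m * q`.
  rcases le_total o m with h | h
  · rw [min_eq_left h]
    have h4 := Nat.lt_mul_div_succ (m - 1) (show 0 < o by omega)
    have h5 := Nat.mul_le_mul_left o hqle
    omega
  · rw [min_eq_right h]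
    exact Nat.le_mul_of_pos_right m ((Nat.succ_pos _).trans_le hqle)

/-- The multiplicities in the minimal polynomial of a multiple of `f(A)` are bounded by the
exponents `blaschkeExponent f A`. -/
theorem minpolyMult_le_blaschkeExponent {n : ℕ} (hn : n ≠ 0) {f : ℂ → ℂ}
    {A E : Matrix (Fin n) (Fin n) ℂ} (hf : ∀ a ∈ spectrum ℂ A, AnalyticAt ℂ f a) {d : ℂ}
    (hd : d ≠ 0) (hE : holoFC f A = d • E) {ν : ℂ} (hν : ν ∈ specFinset (holoFC f A)) :
    minpolyMult E (ν / d) ≤ blaschkeExponent f A ν := by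
  classical
  obtain ⟨P, hP⟩ := exists_isHermiteInterpolant f A
  set T := specFinset (holoFC f A) with hT
  let R : Polynomial ℂ := ∏ ν ∈ T, (Polynomial.X - Polynomial.C (ν / d)) ^ blaschkeExponent f A ν
  have hEP : E = Polynomial.aeval A (Polynomial.C d⁻¹ * P) := by
    rw [map_mul, ← holoFC_eq_aeval hP, hE, Polynomial.aeval_C, Algebra.algebraMap_eq_smul_one,
      smul_mul_assoc, one_mul, smul_smul, inv_mul_cancel₀ hd, one_smul]
  have hR0 : Polynomial.aeval E R = 0 := by
    rw [hEP, ← Polynomial.aeval_comp, ← minpoly.dvd_iff]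
    refine minpoly_dvd_of_forall fun a ha => ?_
    have hmem : f a ∈ T := by
      rw [hT, mem_specFinset, spectrum_holoFC hn]
      exact mem_image_of_mem _ ha
    refine (X_sub_C_pow_dvd_pow_blaschkeExponent hP ha (hf a ha)).trans ?_
    have h1 : R.comp (Polynomial.C d⁻¹ * P) = ∏ ν ∈ T,
        (Polynomial.C d⁻¹ * (P - Polynomial.C ν)) ^ blaschkeExponent f A ν := by
      rw [Polynomial.prod_comp]
      refine Finset.prod_congr rfl fun ν _ => ?_
      simp only [Polynomial.pow_comp, Polynomial.sub_comp, Polynomial.X_comp, Polynomial.C_comp]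
      rw [mul_sub, ← Polynomial.C_mul, div_eq_inv_mul]
    rw [h1]
    refine Dvd.dvd.trans ?_ (Finset.dvd_prod_of_mem _ hmem)
    rw [mul_pow]
    exact dvd_mul_left _ _
  have hdvd : (Polynomial.X - Polynomial.C (ν / d)) ^ minpolyMult E (ν / d) ∣ R :=
    (Polynomial.pow_rootMultiplicity_dvd _ _).trans (minpoly.dvd ℂ E hR0)
  rw [show R = _ from (Finset.mul_prod_erase _ _ hν).symm] at hdvd
  have hcop : IsCoprime ((Polynomial.X - Polynomial.C (ν / d)) ^ minpolyMult E (ν / d))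
      (∏ ν ∈ T.erase ν, (Polynomial.X - Polynomial.C (ν / d)) ^ blaschkeExponent f A ν) := by
    refine IsCoprime.prod_right fun x hx => IsCoprime.pow ?_
    refine Polynomial.pairwise_coprime_X_sub_C Function.injective_id fun h => ?_
    exact Finset.ne_of_mem_erase hx ((div_left_inj' hd).1 h).symm
  exact (pow_dvd_pow_iff (Polynomial.X_sub_C_ne_zero _) (Polynomial.not_isUnit_X_sub_C _)).1
    (hcop.dvd_of_dvd_mul_right hdvd)

/-! ### The two alternatives -/

/-- The two-point Schwarz-Pick inequality for the spectral unit ball. The Blaschke product `b` with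
zeros at the eigenvalues of `E a`, of sufficient multiplicity, annihilates `E a`, so that the
Schwarz lemma applies to `b (E z)`. -/
theorem prod_moebiusDist_le {n : ℕ} (hn : n ≠ 0) {E : ℂ → Matrix (Fin n) (Fin n) ℂ}
    (hE : ∀ i j, DifferentiableOn ℂ (fun z => E z i j) (ball 0 1))
    (hEs : ∀ z ∈ ball (0 : ℂ) 1, spectrum ℂ (E z) ⊆ ball 0 1) {a b : ℂ} (ha : ‖a‖ < 1)
    (hb : ‖b‖ < 1) (hba : b ≠ a) {ι : Type*} {T : Finset ι} {p : ι → ℂ} {q : ι → ℕ}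
    (hp : ∀ i ∈ T, ‖p i‖ < 1)
    (hq : ∀ x ∈ spectrum ℂ (E a), ∃ i ∈ T, p i = x ∧ minpolyMult (E a) x ≤ q i) {μ : ℂ}
    (hμ : μ ∈ spectrum ℂ (E b)) :
    ∏ i ∈ T, moebiusDist μ (p i) ^ q i ≤ moebiusDist b a := by
  have haB : a ∈ ball (0 : ℂ) 1 := mem_ball_zero_iff.2 ha
  have hbB : b ∈ ball (0 : ℂ) 1 := mem_ball_zero_iff.2 hb
  let f : ℂ → ℂ := fun x => ∏ i ∈ T, discAut (p i) x ^ q i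
  have hfd : DifferentiableOn ℂ f (ball 0 1) :=
    differentiableOn_prod_pow fun i hi => differentiableOn_discAut (hp i hi)
  have hfm : ∀ x ∈ ball (0 : ℂ) 1, f x ∈ ball (0 : ℂ) 1 := by
    intro x hx
    obtain ⟨y, hy⟩ := spectrum_nonempty hn (E a)
    obtain ⟨i, hi, -, hle⟩ := hq y hy
    exact mem_ball_zero_iff.2 (norm_prod_pow_lt_one
      (fun i hi => norm_discAut_lt_one (hp i hi) (mem_ball_zero_iff.1 hx))
      ⟨i, hi, (minpolyMult_pos hy).trans_le hle⟩)
  have hzero : holoFC f (E a) = 0 := by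
    refine holoFC_eq_zero (fun x hx => ?_) fun x hx => ?_
    · exact hfd.analyticAt (isOpen_ball.mem_nhds (hEs a haB hx))
    · obtain ⟨i, hi, hpi, hle⟩ := hq x hx
      refine (Nat.cast_le.2 hle).trans (le_analyticOrderAt_prod_pow (fun j hj => ?_) hi ?_)
      · exact (differentiableOn_discAut (hp j hj)).analyticAt
          (isOpen_ball.mem_nhds (hEs a haB hx))
      · simp [discAut, hpi]
  obtain ⟨E', hE', hfac⟩ := exists_eq_discAut_smul
    (fun i j => differentiableOn_holoFC hn isOpen_ball hfd isOpen_ball hE hEs i j) ha hzero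
  have hspec : ∀ z ∈ ball (0 : ℂ) 1, spectrum ℂ (holoFC f (E z)) ⊆ ball 0 1 := by
    intro z hz
    rw [spectrum_holoFC hn]
    rintro _ ⟨x, hx, rfl⟩
    exact hfm x (hEs z hz hx)
  have hd := discAut_ne_zero ha hb hba
  have h1 : f μ ∈ spectrum ℂ (holoFC f (E b)) := by
    rw [spectrum_holoFC hn]; exact mem_image_of_mem _ hμ
  have h2 := smul_mem_spectrum_smul (discAut a b)⁻¹ h1
  rw [hfac b hbB, smul_smul, inv_mul_cancel₀ hd, one_smul] at h2
  have h3 := norm_le_one_of_mem_spectrum hE' hspec ha hfac hbB h2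
  rw [norm_mul, norm_inv, inv_mul_le_iff₀ (norm_pos_iff.2 hd), mul_one] at h3
  simp only [f, norm_prod, norm_pow] at h3
  exact h3

/-- If `c * discAut a z` is, for every `z`, the value of `f` at some eigenvalue of `F z`, then every
solution `x` of `f x = c * discAut a z` is an eigenvalue of `F z`. The equation can be solved
for `z` as a holomorphic function `τ` of `x`, and `det (x - F (τ x))` has uncountably many zeros. -/
theorem mem_spectrum_of_apply_eq {n : ℕ} {Ω : Set ℂ} (hΩ : IsOpen Ω) (hΩc : IsPreconnected Ω)
    {f : ℂ → ℂ} (hf : DifferentiableOn ℂ f Ω) (hfm : MapsTo f Ω (ball 0 1))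
    {F : ℂ → Matrix (Fin n) (Fin n) ℂ}
    (hF : ∀ i j, DifferentiableOn ℂ (fun z => F z i j) (ball 0 1))
    (hFΩ : ∀ z ∈ ball (0 : ℂ) 1, spectrum ℂ (F z) ⊆ Ω) {a c : ℂ} (ha : ‖a‖ < 1) (hc : ‖c‖ = 1)
    (h : ∀ z ∈ ball (0 : ℂ) 1, c * discAut a z ∈ f '' spectrum ℂ (F z)) {z : ℂ}
    (hz : z ∈ ball (0 : ℂ) 1) {x : ℂ} (hx : x ∈ Ω) (hxz : f x = c * discAut a z) :
    x ∈ spectrum ℂ (F z) := by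
  have hc0 : c ≠ 0 := by rintro rfl; simp at hc
  have ha' : ‖-a‖ < 1 := by rwa [norm_neg]
  -- `discAut (-a)` is the inverse of `discAut a`.
  let τ : ℂ → ℂ := fun x => discAut (-a) (c⁻¹ * f x)
  have hcf : ∀ x ∈ Ω, ‖c⁻¹ * f x‖ < 1 := fun x hx => by
    simpa [hc] using hfm hx
  have hτm : MapsTo τ Ω (ball 0 1) := fun x hx =>
    mem_ball_zero_iff.2 (norm_discAut_lt_one ha' (hcf x hx))
  have hτd : DifferentiableOn ℂ τ Ω := (differentiableOn_discAut ha').comp (hf.const_mul _)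
    fun x hx => mem_ball_zero_iff.2 (hcf x hx)
  have hτ : ∀ z ∈ ball (0 : ℂ) 1, ∀ x, f x = c * discAut a z → τ x = z := by
    intro z hz x hx
    simp only [τ, hx, inv_mul_cancel_left₀ hc0]
    exact discAut_neg_discAut ha (mem_ball_zero_iff.1 hz)
  have hzero := eqOn_zero_of_not_countable hΩ hΩc
    (h := fun x => (Matrix.scalar (Fin n) x - F (τ x)).det) ?_ ?_ hx
  · rw [mem_spectrum_iff_det, ← hτ z hz x hxz]
    exact hzero
  · refine differentiableOn_det fun i j => ?_
    have h1 : DifferentiableOn ℂ (fun x : ℂ => Matrix.scalar (Fin n) x i j) Ω := by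
      by_cases hij : i = j
      · subst hij; simp; fun_prop
      · simp [hij]
    exact h1.fun_sub ((hF i j).comp hτd hτm)
  · intro hcount
    have hsub : ball (0 : ℂ) 1 ⊆ τ '' {x ∈ Ω | (Matrix.scalar (Fin n) x - F (τ x)).det = 0} := by
      intro w hw
      obtain ⟨y, hy, hyw⟩ := h w hw
      refine ⟨y, ⟨hFΩ w hw hy, ?_⟩, hτ w hw y hyw⟩
      rw [hτ w hw y hyw]
      exact (mem_spectrum_iff_det _ _).1 hy
    obtain ⟨w, hw, hw'⟩ := (((hcount.image τ).mono hsub).dense_compl ℂ).inter_open_nonempty _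
      isOpen_ball ⟨0, mem_ball_self one_pos⟩
    exact hw' hw

theorem otherMax_ne (k : Fin 3) : otherMax k ≠ k :=
  Finset.ne_of_mem_erase (Finset.max'_mem _ (erase_nonempty k))

theorem otherMin_ne (k : Fin 3) : otherMin k ≠ k :=
  Finset.ne_of_mem_erase (Finset.min'_mem _ (erase_nonempty k))

theorem otherMin_ne_otherMax (k : Fin 3) : otherMin k ≠ otherMax k := by
  revert k; decide

theorem theorem1p9 (Ω : Set ℂ) (hΩo : IsOpen Ω) (hΩc : IsConnected Ω)
    (hΩ : IsCaratheodoryHyperbolic Ω) (n : ℕ) (hn : 2 ≤ n)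
    (ζ : Fin 3 → ℂ) (hζ : ∀ j, ζ j ∈ Metric.ball (0 : ℂ) 1) (hζinj : Function.Injective ζ)
    (W : Fin 3 → Matrix (Fin n) (Fin n) ℂ) (hW : ∀ j, W j ∈ matricialDomain n Ω)
    (hF : ∃ F : ℂ → Matrix (Fin n) (Fin n) ℂ,
      (∀ a b, DifferentiableOn ℂ (fun x => F x a b) (Metric.ball 0 1)) ∧
      Set.MapsTo F (Metric.ball 0 1) (matricialDomain n Ω) ∧ ∀ j, F (ζ j) = W j) :
    ∀ k : Fin 3, ∀ z ∈ Ω \ spectrum ℂ (W k),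
      let B : ℂ → ℂ := genMinBlaschke Ω (W k) z
      let G : Fin 3 := otherMax k
      let L : Fin 3 := otherMin k
      let ψ : ℂ → ℂ := discAut (ζ k)
      (spectrum ℂ (holoFC B (W G)) ⊆ Metric.ball 0 ‖ψ (ζ G)‖ ∧
        spectrum ℂ (holoFC B (W L)) ⊆ Metric.ball 0 ‖ψ (ζ L)‖ ∧
        (∀ μ ∈ spectrum ℂ (holoFC B (W L)),
          ∏ ν ∈ specFinset (holoFC B (W G)),
              moebiusDist (μ / ψ (ζ L)) (ν / ψ (ζ G)) ^ blaschkeExponent B (W G) ν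
            ≤ moebiusDist (ζ L) (ζ G)) ∧
        (∀ μ ∈ spectrum ℂ (holoFC B (W G)),
          ∏ ν ∈ specFinset (holoFC B (W L)),
              moebiusDist (μ / ψ (ζ G)) (ν / ψ (ζ L)) ^ blaschkeExponent B (W L) ν
            ≤ moebiusDist (ζ L) (ζ G))) ∨
      ∃ θ : ℝ,
        {x ∈ Ω | B x = Complex.exp (θ * Complex.I) * ψ (ζ G)} ⊆ spectrum ℂ (W G) ∧
        {x ∈ Ω | B x = Complex.exp (θ * Complex.I) * ψ (ζ L)} ⊆ spectrum ℂ (W L) := by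
  obtain ⟨F, hFd, hFm, hFW⟩ := hF
  intro k z hz B G L ψ
  have hn0 : n ≠ 0 := by omega
  have hk : ‖ζ k‖ < 1 := mem_ball_zero_iff.1 (hζ k)
  have hBd : DifferentiableOn ℂ B Ω := differentiableOn_genMinBlaschke hΩo hΩc (hW k) hz.1
  have hBm : MapsTo B Ω (ball 0 1) := mapsTo_genMinBlaschke hn0 hΩo hΩc (hW k) hz.1
  have hFs : ∀ w ∈ ball (0 : ℂ) 1, spectrum ℂ (F w) ⊆ Ω := fun w hw => hFm hw
  have hspec : ∀ w ∈ ball (0 : ℂ) 1, spectrum ℂ (holoFC B (F w)) ⊆ ball 0 1 := by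
    intro w hw
    rw [spectrum_holoFC hn0]
    rintro _ ⟨x, hx, rfl⟩
    exact hBm (hFs w hw hx)
  have hzero : holoFC B (F (ζ k)) = 0 := by
    rw [hFW]; exact holoFC_genMinBlaschke_self hΩo hΩc (hW k) hz.1
  obtain ⟨E, hE, hfac⟩ := exists_eq_discAut_smul
    (fun i j => differentiableOn_holoFC hn0 hΩo hBd isOpen_ball hFd hFs i j) hk hzero
  have hle : ∀ w ∈ ball (0 : ℂ) 1, ∀ c ∈ spectrum ℂ (E w), ‖c‖ ≤ 1 := fun w hw c hc =>
    norm_le_one_of_mem_spectrum hE hspec hk hfac hw hc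
  -- A unimodular eigenvalue of some `E w` leads to the second alternative, its absence to the first.
  by_cases hone : ∃ w ∈ ball (0 : ℂ) 1, ∃ c ∈ spectrum ℂ (E w), ‖c‖ = 1
  · right
    obtain ⟨w, hw, c, hc, hc1⟩ := hone
    obtain ⟨θ, hθ⟩ := (Complex.norm_eq_one_iff c).1 hc1
    have himg : ∀ v ∈ ball (0 : ℂ) 1, c * discAut (ζ k) v ∈ B '' spectrum ℂ (F v) := by
      intro v hv
      rw [← spectrum_holoFC hn0, hfac v hv, mul_comm]
      exact smul_mem_spectrum_smul _ (mem_spectrum_of_norm_eq_one isOpen_ball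
        (convex_ball 0 1).isPreconnected hE hle hw hc hc1 hv)
    have hsol : ∀ j, {x ∈ Ω | B x = Complex.exp (θ * Complex.I) * ψ (ζ j)} ⊆ spectrum ℂ (W j) := by
      rintro j x ⟨hx, hxB⟩
      rw [hθ] at hxB
      rw [← hFW j]
      exact mem_spectrum_of_apply_eq hΩo hΩc.isPreconnected hBd hBm hFd hFs hk hc1 himg (hζ j) hx hxB
    exact ⟨θ, hsol G, hsol L⟩
  · left
    push Not at hone
    have hEs : ∀ w ∈ ball (0 : ℂ) 1, spectrum ℂ (E w) ⊆ ball 0 1 := fun w hw c hc =>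
      mem_ball_zero_iff.2 (lt_of_le_of_ne (hle w hw c hc) (hone w hw c hc))
    have hfacW : ∀ j, holoFC B (W j) = ψ (ζ j) • E (ζ j) := fun j => by
      rw [← hFW j]; exact hfac _ (hζ j)
    have hψ : ∀ j, j ≠ k → ψ (ζ j) ≠ 0 := fun j hj =>
      discAut_ne_zero hk (mem_ball_zero_iff.1 (hζ j)) (hζinj.ne hj)
    have hdiv : ∀ j, j ≠ k → ∀ ν ∈ spectrum ℂ (holoFC B (W j)),
        ν / ψ (ζ j) ∈ spectrum ℂ (E (ζ j)) := by
      intro j hj ν hν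
      have h := smul_mem_spectrum_smul (ψ (ζ j))⁻¹ hν
      rwa [hfacW, smul_smul, inv_mul_cancel₀ (hψ j hj), one_smul, ← div_eq_inv_mul] at h
    have hdivlt : ∀ j, j ≠ k → ∀ ν ∈ spectrum ℂ (holoFC B (W j)), ‖ν / ψ (ζ j)‖ < 1 :=
      fun j hj ν hν => mem_ball_zero_iff.1 (hEs _ (hζ j) (hdiv j hj ν hν))
    have hball : ∀ j, j ≠ k → spectrum ℂ (holoFC B (W j)) ⊆ ball 0 ‖ψ (ζ j)‖ := by
      intro j hj ν hν
      have h := hdivlt j hj ν hν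
      rw [norm_div, div_lt_one (norm_pos_iff.2 (hψ j hj))] at h
      exact mem_ball_zero_iff.2 h
    have hpick : ∀ i j, i ≠ k → j ≠ k → i ≠ j → ∀ μ ∈ spectrum ℂ (holoFC B (W i)),
        ∏ ν ∈ specFinset (holoFC B (W j)),
          moebiusDist (μ / ψ (ζ i)) (ν / ψ (ζ j)) ^ blaschkeExponent B (W j) ν
        ≤ moebiusDist (ζ i) (ζ j) := by
      intro i j hi hj hij μ hμ
      refine prod_moebiusDist_le hn0 hE hEs (mem_ball_zero_iff.1 (hζ j))
        (mem_ball_zero_iff.1 (hζ i)) (hζinj.ne hij) (p := fun ν => ν / ψ (ζ j))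
        (fun ν hν => hdivlt j hj ν (mem_specFinset.1 hν)) (fun x hx => ?_) (hdiv i hi μ hμ)
      have hmem : ψ (ζ j) * x ∈ specFinset (holoFC B (W j)) := by
        rw [mem_specFinset, hfacW]; exact smul_mem_spectrum_smul _ hx
      have hx' : ψ (ζ j) * x / ψ (ζ j) = x := mul_div_cancel_left₀ x (hψ j hj)
      refine ⟨ψ (ζ j) * x, hmem, hx', ?_⟩
      have h := minpolyMult_le_blaschkeExponent hn0
        (fun a ha => hBd.analyticAt (hΩo.mem_nhds (hW j ha))) (hψ j hj) (hfacW j) hmem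
      rwa [hx'] at h
    have hLG := otherMin_ne_otherMax k
    refine ⟨hball G (otherMax_ne k), hball L (otherMin_ne k),
      hpick L G (otherMin_ne k) (otherMax_ne k) hLG, fun μ hμ => ?_⟩
    rw [moebiusDist_comm (ζ L)]
    exact hpick G L (otherMax_ne k) (otherMin_ne k) hLG.symm μ hμ
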